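/- Let $\tau\in(0,\infty]$ be a random variable (the search time without resetting) with distribution function $F_\tau(t)=\mathbb{P}(\tau\le t)$ satisfying $F_\tau(0)=0$ and $F_\tau(t)>0$ for some $t\in(0,\infty)$. For a resetting rate $r>0$ let $\sigma=Y/r$, where $Y$ is independent of $\tau$ and exponentially distributed with unit mean, $\mathbb{P}(Y>y)=e^{-y}$ for $y\ge 0$. Let $p=p(r)=\mathbb{P}(\tau<\sigma)$, and let $$T=\sum_{n=1}^{R}\sigma_n^-+\tau^-,$$ where $R,\sigma_1^-,\sigma_2^-,\dots,\tau^-$ are independent random variables with $\mathbb{P}(R=n)=(1-p)^np$ for $n\in\{0,1,2,\dots\}$, $\mathbb{P}(\sigma_n^->t)=\mathbb{P}(\sigma>t\mid\sigma<\tau)$ for all $n\ge1$ and $t\in\mathbb{R}$, and $\mathbb{P}(\tau^->t)=\mathbb{P}(\tau>t\mid\tau<\sigma)$ for all $t\in\mathbb{R}$. Write $f\sim g$ for $f/g\to1$. If $$F_\tau(t)\sim A\,t^{b}e^{-C/t}\quad\text{as }t\to0^+$$ for some $A>0$, $C>0$ and $b\in\mathbb{R}$, then $$p\sim A\sqrt{\pi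 C^{\frac{2b+1}{2}}}\;r^{\frac{1-2b}{4}}\exp(-\sqrt{4Cr})\quad\text{as }r\to\infty,$$ and for every integer $m\ge1$ the moment $\mathbb{E}[T^m]$ is finite for all sufficiently large $r$ and $$\mathbb{E}[T^m]\sim m!\left(\frac{1}{A\sqrt{\pi C^{\frac{2b+1}{2}}}}\;r^{\frac{2b-5}{4}}\exp(\sqrt{4Cr})\right)^{m}\quad\text{as }r\to\infty.$$ -/

import Mathlib

open MeasureTheory ProbabilityTheory Filter Topology Asymptotics

noncomputable section

/-- The cumulative distribution function `F_τ(t) = ℙ(τ ≤ t)` of the search time `τ` without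
resetting. The search time may be infinite with positive probability, so it is extended real. -/
def searchCDF {Ω : Type*} [MeasurableSpace Ω] (P : Measure Ω) (τ : Ω → EReal) (t : ℝ) : ℝ :=
  P.real {ω | τ ω ≤ (t : EReal)}

/-- The resetting time `σ = Y / r` with resetting rate `r`. -/
def resetTime {Ω : Type*} (Y : Ω → ℝ) (r : ℝ) (ω : Ω) : ℝ := Y ω / r

/-- The event `{τ < σ}` that the search ends before resetting. -/
def successEvent {Ω : Type*} (τ : Ω → EReal) (Y : Ω → ℝ) (r : ℝ) : Set Ω :=
  {ω | τ ω < (resetTime Y r ω : EReal)}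

/-- The event `{σ < τ}` that resetting occurs before the search ends. -/
def failureEvent {Ω : Type*} (τ : Ω → EReal) (Y : Ω → ℝ) (r : ℝ) : Set Ω :=
  {ω | (resetTime Y r ω : EReal) < τ ω}

/-- The probability `p(r) = ℙ(τ < σ)` of a successful search prior to resetting. -/
def successProb {Ω : Type*} [MeasurableSpace Ω] (P : Measure Ω) (τ : Ω → EReal) (Y : Ω → ℝ)
    (r : ℝ) : ℝ :=
  P.real (successEvent τ Y r)

/-- A search time `τ` (positive almost surely and not almost surely infinite) together with an
independent random variable `Y` that drives the resetting. -/
structure IsSearchWithResetting {Ω : Type*} [MeasurableSpace Ω] (P : Measure Ω)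
    (τ : Ω → EReal) (Y : Ω → ℝ) : Prop where
  measurable_search : Measurable τ
  measurable_reset : Measurable Y
  indep : IndepFun τ Y P
  cdf_zero : searchCDF P τ 0 = 0
  cdf_pos : ∃ t : ℝ, 0 < t ∧ 0 < searchCDF P τ t

/-- `Y` is exponential with unit mean: its survival probability is `ℙ(Y > y) = exp (-y)` for
`y ≥ 0`. -/
def IsUnitExponential {Ω : Type*} [MeasurableSpace Ω] (P : Measure Ω) (Y : Ω → ℝ) : Prop :=
  ∀ y : ℝ, 0 ≤ y → P.real {ω | y < Y ω} = Real.exp (-y)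

/-- `R`, `(σm n)` and `τm` are the ingredients of the search time with resetting at rate `r`:
the number `R` of unsuccessful searches is geometric with success probability `p(r)`, each
`σm n` is distributed as `σ` given `σ < τ`, `τm` is distributed as `τ` given `τ < σ`, and the
variables `R`, `σm 0`, `σm 1`, …, `τm` are mutually independent (the last three fields). -/
structure IsResetDecomposition {Ω : Type*} [MeasurableSpace Ω] (P : Measure Ω)
    (τ : Ω → EReal) (Y : Ω → ℝ) (r : ℝ)
    {Ω₁ : Type*} [MeasurableSpace Ω₁] (Q : Measure Ω₁)
    (R : Ω₁ → ℕ) (σm : ℕ → Ω₁ → ℝ) (τm : Ω₁ → ℝ) : Prop where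
  measurable_R : Measurable R
  measurable_σm : ∀ n, Measurable (σm n)
  measurable_τm : Measurable τm
  prob_R : ∀ n : ℕ, Q.real {ω | R ω = n} = (1 - successProb P τ Y r) ^ n * successProb P τ Y r
  survival_σm : ∀ (n : ℕ) (t : ℝ),
    Q.real {ω | t < σm n ω} = (cond P (failureEvent τ Y r)).real {ω | t < resetTime Y r ω}
  survival_τm : ∀ t : ℝ,
    Q.real {ω | t < τm ω} = (cond P (successEvent τ Y r)).real {ω | (t : EReal) < τ ω}
  indep_σm : iIndepFun σm Q
  indep_σm_τm : IndepFun (fun ω (n : ℕ) => σm n ω) τm Q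
  indep_R : IndepFun R (fun ω => ((fun n : ℕ => σm n ω), τm ω)) Q

/-- The total search time with resetting: the sum of the `R` unsuccessful search times plus the
single successful one. The unsuccessful search times are numbered from `0`. -/
def totalSearchTime {Ω₁ : Type*} (R : Ω₁ → ℕ) (σm : ℕ → Ω₁ → ℝ) (τm : Ω₁ → ℝ) (ω : Ω₁) : ℝ :=
  (∑ n ∈ Finset.range (R ω), σm n ω) + τm ω

end

open scoped ENNReal

/-! Conditioning on `Y` gives `p = ∫₀^∞ F_τ(y/r) e^{-y} dy`, whose integrand is of order `A (y/r)^b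
exp(-(y + Cr/y))` where `y/r` is small. The phase `y + Cr/y` has its minimum `2√(Cr) = √(4Cr)` at `y
= s²`, with `s = (Cr)^{1/4}`, and the peak has width of order `s`. Under `y = s² e^{u/s}` the excess
of the phase over its minimum becomes `s²(e^{u/s} + e^{-u/s} - 2)`, which tends to `u²` and is at
least `u²`. Dominated convergence then leaves `∫ e^{-u²} du = √π` (`tendsto_integral_laplace`,
`laplace_isEquivalent`).

For the moments, resetting almost surely precedes success once `r` is large, so `r σ⁻` is nearly a
unit exponential and `T` is nearly a geometric sum of exponentials of mean `1/r`. Such a sum is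
itself nearly exponential of mean `1/(rp)`, whence `E[(rpT)^m] → m!` (`tendsto_scaled_moment`). The
limit is a squeeze. The upper bound compares the moments of `σ⁻` with exponential ones and sums a
negative binomial series (`lintegral_geometric_sum_pow_le`, `scaled_moment_le`). The lower bound is
Jensen's inequality together with `n^m ≥ m! (n choose m)` (`le_lintegral_geometric_sum_pow`,
`le_scaled_moment`). The bounds live in `ℝ≥0∞`, so finiteness of the moments is a consequence.
Inserting the asymptotics of `p` finishes the proof. -/

/-! ### Laplace's method for `∫ F(y/r) e^{-y} dy` -/

theorem sq_le_exp_add_exp_neg_sub_two (v : ℝ) : v ^ 2 ≤ Real.exp v + Real.exp (-v) - 2 := by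
  have h1 : |v / 2| ≤ |Real.sinh (v / 2)| := by
    rw [Real.abs_sinh]
    exact Real.self_le_sinh_iff.2 (abs_nonneg _)
  have h2 := sq_le_sq.2 h1
  have h3 := Real.sinh_sq (v / 2)
  have h4 := Real.cosh_two_mul (v / 2)
  rw [mul_div_cancel₀ v two_ne_zero, Real.cosh_eq] at h4
  nlinarith

/-- Since `e^v + e^{-v} - 2 = (e^{v/2} - e^{-v/2})²`, the expression is the square of a difference
quotient at `0` with step `1/s`. -/
theorem tendsto_sq_mul_exp_add_exp_neg_sub_two (u : ℝ) :
    Tendsto (fun s : ℝ => s ^ 2 * (Real.exp (u / s) + Real.exp (-(u / s)) - 2)) atTop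
      (𝓝 (u ^ 2)) := by
  have hd : HasDerivAt (fun x : ℝ => Real.exp (u / 2 * x) - Real.exp (-(u / 2) * x)) u 0 := by
    have h1 : HasDerivAt (fun x : ℝ => Real.exp (u / 2 * x)) (u / 2) 0 := by
      simpa using ((hasDerivAt_id (0 : ℝ)).const_mul (u / 2)).exp
    have h2 : HasDerivAt (fun x : ℝ => Real.exp (-(u / 2) * x)) (-(u / 2)) 0 := by
      simpa using ((hasDerivAt_id (0 : ℝ)).const_mul (-(u / 2))).exp
    have h3 := h1.sub h2
    rw [sub_neg_eq_add, add_halves] at h3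
    exact h3
  have ht := (hd.tendsto_slope_zero_right.comp tendsto_inv_atTop_nhdsGT_zero).pow 2
  refine ht.congr' ?_
  filter_upwards [eventually_gt_atTop 0] with s hs
  have e1 : Real.exp (u / s) = Real.exp (u / 2 * s⁻¹) ^ 2 := by
    rw [← Real.exp_nat_mul]; congr 1; push_cast; field_simp
  have e2 : Real.exp (-(u / s)) = Real.exp (-(u / 2) * s⁻¹) ^ 2 := by
    rw [← Real.exp_nat_mul]; congr 1; push_cast; field_simp
  have e3 : Real.exp (u / 2 * s⁻¹) * Real.exp (-(u / 2) * s⁻¹) = 1 := by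
    rw [← Real.exp_add]; simp
  simp only [Function.comp_apply, inv_inv, smul_eq_mul, zero_add, mul_zero, Real.exp_zero,
    sub_self, sub_zero]
  rw [e1, e2]
  linear_combination (2 * s ^ 2) * (-e3)

/-- The logarithmic substitution makes the phase symmetric in `u`; dividing by `s` brings the peak
to unit width when `l = s²`. -/
theorem integral_Ioi_eq_integral_comp_mul_exp (g : ℝ → ℝ) {l s : ℝ} (hl : 0 < l) (hs : 0 < s) :
    ∫ y in Set.Ioi 0, g y = ∫ u : ℝ, l * Real.exp (u / s) / s * g (l * Real.exp (u / s)) := by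
  have himg : (fun u : ℝ => l * Real.exp (u / s)) '' Set.univ = Set.Ioi 0 := by
    ext y
    simp only [Set.image_univ, Set.mem_range, Set.mem_Ioi]
    constructor
    · rintro ⟨u, rfl⟩; positivity
    · intro hy
      refine ⟨s * Real.log (y / l), ?_⟩
      rw [mul_div_cancel_left₀ _ hs.ne', Real.exp_log (by positivity)]
      field_simp
  have hd : ∀ u ∈ (Set.univ : Set ℝ), HasDerivWithinAt (fun u : ℝ => l * Real.exp (u / s))
      (l * Real.exp (u / s) / s) Set.univ u := by
    intro u _
    have h1 : HasDerivAt (fun u : ℝ => u / s) (1 / s) u := (hasDerivAt_id u).div_const s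
    have h2 := (h1.exp.const_mul l).hasDerivWithinAt (s := Set.univ)
    rwa [← mul_assoc, mul_one_div] at h2
  have hinj : Set.InjOn (fun u : ℝ => l * Real.exp (u / s)) Set.univ := by
    intro a _ b _ hab
    have := Real.exp_injective (mul_left_cancel₀ hl.ne' hab)
    field_simp at this
    exact this
  rw [← himg, integral_image_eq_integral_abs_deriv_smul MeasurableSet.univ hd hinj, setIntegral_univ]
  refine integral_congr_ae (Eventually.of_forall fun u => ?_)
  simp only [smul_eq_mul]
  rw [abs_of_pos (by positivity)]

/-- A bounded function with the given behaviour at `0` is globally dominated. -/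
theorem exists_bound_of_isEquivalent {F : ℝ → ℝ} (hF1 : ∀ t, F t ≤ 1) {A C b : ℝ}
    (hA : 0 < A) (hC : 0 < C)
    (hF : F ~[𝓝[>] 0] (fun t : ℝ => A * t ^ b * Real.exp (-C / t))) :
    ∃ M : ℝ, 0 < M ∧ ∀ t : ℝ, 0 < t →
      F t ≤ M * (t ^ b + t ^ |b|) * Real.exp (-C / t) := by
  have h1 := hF.isBigO.bound
  obtain ⟨K, hK⟩ := h1
  obtain ⟨d, hd, hdK⟩ := (nhdsGT_basis (0 : ℝ)).eventually_iff.1 hK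
  -- The first summand serves `t < d`, where the asymptotic bound holds. The second serves `t ≥ d`:
  -- there `F ≤ 1`, and `t^|b| e^{-C/t}` is increasing, even when `b < 0`.
  refine ⟨|K| * A + 1 / (d ^ |b| * Real.exp (-C / d)), by positivity, fun t ht => ?_⟩
  have hp1 : 0 < 1 / (d ^ |b| * Real.exp (-C / d)) := by positivity
  rcases lt_or_ge t d with htd | htd
  · have h := hdK (x := t) ⟨ht, htd⟩
    have h2 : ‖A * t ^ b * Real.exp (-C / t)‖ = A * t ^ b * Real.exp (-C / t) :=
      Real.norm_of_nonneg (by positivity)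
    rw [h2] at h
    calc F t ≤ ‖F t‖ := Real.le_norm_self _
      _ ≤ K * (A * t ^ b * Real.exp (-C / t)) := h
      _ ≤ |K| * (A * t ^ b * Real.exp (-C / t)) := by gcongr; exact le_abs_self K
      _ = (|K| * A) * t ^ b * Real.exp (-C / t) := by ring
      _ ≤ _ := by
        have : 0 < t ^ |b| := by positivity
        gcongr
        · exact le_add_of_nonneg_right hp1.le
        · linarith
  · calc F t ≤ 1 := hF1 t
      _ = 1 / (d ^ |b| * Real.exp (-C / d)) * d ^ |b| * Real.exp (-C / d) := by
        field_simp
      _ ≤ _ := by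
        have : 0 < t ^ b := by positivity
        have h3 : d ^ |b| ≤ t ^ |b| := Real.rpow_le_rpow (by exact hd.le) htd (abs_nonneg b)
        have h4 : -C / d ≤ -C / t := by
          rw [neg_div, neg_div, neg_le_neg_iff]
          exact div_le_div_of_nonneg_left hC.le hd htd
        gcongr
        · exact le_add_of_nonneg_left (by positivity)
        · linarith

/-- Laplace's method after the substitution `t = (l / r) * exp (u / s)`, with `l = s ^ 2`. -/
theorem tendsto_integral_laplace {F : ℝ → ℝ} (hFm : Measurable F) (hF0 : ∀ t, 0 ≤ F t)
    (hF1 : ∀ t, F t ≤ 1) {A C b : ℝ} (hA : 0 < A) (hC : 0 < C)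
    (hF : F ~[𝓝[>] 0] (fun t : ℝ => A * t ^ b * Real.exp (-C / t))) :
    Tendsto (fun s : ℝ => ∫ u : ℝ, F (C / s ^ 2 * Real.exp (u / s)) / (A * (C / s ^ 2) ^ b) *
      Real.exp (-s ^ 2 * Real.exp (u / s) + 2 * s ^ 2) * Real.exp (u / s)) atTop
      (𝓝 (Real.sqrt Real.pi)) := by
  have hgauss : ∫ u : ℝ, Real.exp (-u ^ 2) = Real.sqrt Real.pi := by
    simpa using integral_gaussian 1
  obtain ⟨M, hM, hb⟩ := exists_bound_of_isEquivalent hF1 hA hC hF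
  have hsmall : ∀ᶠ s : ℝ in atTop, C / s ^ 2 ≤ 1 := by
    have : Tendsto (fun s : ℝ => C / s ^ 2) atTop (𝓝 0) :=
      tendsto_const_nhds.div_atTop (tendsto_pow_atTop two_ne_zero)
    exact this.eventually_le_const one_pos
  rw [← hgauss]
  have hphase : ∀ s u : ℝ, 0 < s → -C / (C / s ^ 2 * Real.exp (u / s)) =
      -s ^ 2 * Real.exp (-(u / s)) := by
    intro s u hs
    rw [Real.exp_neg]
    field_simp
  have hcomb : ∀ s u : ℝ, Real.exp (-s ^ 2 * Real.exp (-(u / s))) *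
      Real.exp (-s ^ 2 * Real.exp (u / s) + 2 * s ^ 2) =
      Real.exp (-(s ^ 2 * (Real.exp (u / s) + Real.exp (-(u / s)) - 2))) := by
    intro s u
    rw [← Real.exp_add]; congr 1; ring
  -- The power of `t` contributes `e^{|b||v|}` and the Jacobian `e^v`, together at most `e^{k|u|}`.
  -- Then `k|u| - u² ≤ k²/2 - u²/2` gives an integrable Gaussian majorant.
  set k : ℝ := |b| + 1 with hk
  refine tendsto_integral_filter_of_dominated_convergence
    (fun u => 2 * M / A * Real.exp (k ^ 2 / 2) * Real.exp (-(1 / 2) * u ^ 2)) ?_ ?_ ?_ ?_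
  · exact Eventually.of_forall fun s => by fun_prop
  -- `C/s² ≤ 1` lets `t^|b|` be absorbed into the `t^b` bound, and `s ≥ 1` gives `|u/s| ≤ |u|`.
  · filter_upwards [hsmall, eventually_ge_atTop 1] with s hs hs1
    refine Eventually.of_forall fun u => ?_
    have hs0 : 0 < s := by linarith
    set v := u / s with hv
    have hx : 0 < Real.exp v := Real.exp_pos v
    set e := C / s ^ 2 with he
    have hepos : 0 < e := by positivity
    rw [Real.norm_of_nonneg (by have := hF0 (e * Real.exp v); positivity)]
    have h1 := hb (e * Real.exp v) (by positivity)
    rw [hphase s u hs0] at h1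
    have hvu : |v| ≤ |u| := by
      rw [hv, abs_div, abs_of_pos hs0]
      exact div_le_self (abs_nonneg u) hs1
    have hpow1 : (e * Real.exp v) ^ b ≤ e ^ b * Real.exp (|b| * |v|) := by
      rw [Real.mul_rpow hepos.le hx.le, ← Real.exp_mul]
      have : v * b ≤ |b| * |v| := by
        rw [mul_comm, ← abs_mul]; exact le_abs_self _
      gcongr
    have hpow2 : (e * Real.exp v) ^ |b| ≤ e ^ b * Real.exp (|b| * |v|) := by
      rw [Real.mul_rpow hepos.le hx.le, ← Real.exp_mul]
      have : e ^ |b| ≤ e ^ b := Real.rpow_le_rpow_of_exponent_ge hepos hs (le_abs_self b)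
      have h3 : v * |b| ≤ |b| * |v| := by
        rw [mul_comm]; gcongr; exact le_abs_self v
      gcongr
    have h2 : F (e * Real.exp v) / (A * e ^ b) ≤
        2 * M / A * Real.exp (|b| * |v|) * Real.exp (-s ^ 2 * Real.exp (-v)) := by
      rw [div_le_iff₀ (by positivity)]
      calc F (e * Real.exp v) ≤ M * ((e * Real.exp v) ^ b + (e * Real.exp v) ^ |b|) *
            Real.exp (-s ^ 2 * Real.exp (-v)) := h1
        _ ≤ M * (e ^ b * Real.exp (|b| * |v|) + e ^ b * Real.exp (|b| * |v|)) *
            Real.exp (-s ^ 2 * Real.exp (-v)) := by gcongr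
        _ = _ := by field_simp; ring
    calc F (e * Real.exp v) / (A * e ^ b) * Real.exp (-s ^ 2 * Real.exp v + 2 * s ^ 2) *
          Real.exp v
        ≤ (2 * M / A * Real.exp (|b| * |v|) * Real.exp (-s ^ 2 * Real.exp (-v))) *
          Real.exp (-s ^ 2 * Real.exp v + 2 * s ^ 2) * Real.exp v := by gcongr
      _ = 2 * M / A * Real.exp (|b| * |v| + v +
          -(s ^ 2 * (Real.exp v + Real.exp (-v) - 2))) := by
        rw [Real.exp_add (_ + v), Real.exp_add _ v, ← hcomb s u]; ring
      _ ≤ 2 * M / A * Real.exp (k ^ 2 / 2 + -(1 / 2) * u ^ 2) := by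
        refine mul_le_mul_of_nonneg_left (Real.exp_le_exp.2 ?_) (by positivity)
        have h4 := sq_le_exp_add_exp_neg_sub_two v
        have h5 : s ^ 2 * v ^ 2 = u ^ 2 := by rw [hv]; field_simp
        have h6 : u ^ 2 ≤ s ^ 2 * (Real.exp v + Real.exp (-v) - 2) := by
          rw [← h5]; gcongr
        have h7 : |b| * |v| + v ≤ k * |u| := by
          have := le_abs_self v
          have h8 : |b| * |v| ≤ |b| * |u| := by gcongr
          rw [hk]; linarith
        have h9 : u ^ 2 = |u| ^ 2 := (sq_abs u).symm
        nlinarith [sq_nonneg (k - |u|)]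
      _ = _ := by rw [Real.exp_add]; ring
  · exact (integrable_exp_neg_mul_sq (by norm_num)).const_mul _
  · refine Eventually.of_forall fun u => ?_
    have hv : Tendsto (fun s : ℝ => u / s) atTop (𝓝 0) :=
      tendsto_const_nhds.div_atTop tendsto_id
    have hexp : Tendsto (fun s : ℝ => Real.exp (u / s)) atTop (𝓝 1) := by
      rw [← Real.exp_zero]
      exact (Real.continuous_exp.tendsto 0).comp hv
    have harg : Tendsto (fun s : ℝ => C / s ^ 2 * Real.exp (u / s)) atTop (𝓝[>] 0) := by
      refine tendsto_nhdsWithin_iff.2 ⟨?_, ?_⟩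
      · have : Tendsto (fun s : ℝ => C / s ^ 2) atTop (𝓝 0) :=
          tendsto_const_nhds.div_atTop (tendsto_pow_atTop two_ne_zero)
        simpa using this.mul hexp
      · filter_upwards [eventually_gt_atTop 0] with s hs
        exact Set.mem_Ioi.2 (by positivity)
    have hratio : Tendsto (fun t : ℝ => F t / (A * t ^ b * Real.exp (-C / t))) (𝓝[>] 0) (𝓝 1) := by
      refine (isEquivalent_iff_tendsto_one ?_).1 hF
      filter_upwards [self_mem_nhdsWithin] with t ht
      have : 0 < t := ht
      positivity
    have hpw : Tendsto (fun s : ℝ => Real.exp (u / s) ^ b) atTop (𝓝 1) := by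
      simpa using hexp.rpow_const (p := b) (Or.inl one_ne_zero)
    have hmain := (((hratio.comp harg).mul hpw).mul
      ((Real.continuous_exp.tendsto _).comp
        (tendsto_sq_mul_exp_add_exp_neg_sub_two u).neg)).mul hexp
    simp only [one_mul, mul_one] at hmain
    refine hmain.congr' ?_
    filter_upwards [eventually_gt_atTop 0] with s hs
    simp only [Function.comp_apply]
    rw [hphase s u hs, ← hcomb s u, Real.mul_rpow (by positivity) (by positivity)]
    field_simp

theorem laplace_isEquivalent {F : ℝ → ℝ} (hFm : Measurable F) (hF0 : ∀ t, 0 ≤ F t)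
    (hF1 : ∀ t, F t ≤ 1) {A C b : ℝ} (hA : 0 < A) (hC : 0 < C)
    (hF : F ~[𝓝[>] 0] (fun t : ℝ => A * t ^ b * Real.exp (-C / t))) :
    (fun r : ℝ => ∫ y in Set.Ioi 0, F (y / r) * Real.exp (-y)) ~[atTop]
      (fun r : ℝ => A * Real.sqrt (Real.pi * C ^ ((2 * b + 1) / 2)) * r ^ ((1 - 2 * b) / 4) *
        Real.exp (-Real.sqrt (4 * C * r))) := by
  have hs : Tendsto (fun r : ℝ => (C * r) ^ (1 / 4 : ℝ)) atTop atTop :=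
    (tendsto_rpow_atTop (by norm_num)).comp (tendsto_id.const_mul_atTop hC)
  have hlim := (tendsto_integral_laplace hFm hF0 hF1 hA hC hF).comp hs
  have hpi : Real.sqrt Real.pi ≠ 0 := (Real.sqrt_pos.2 Real.pi_pos).ne'
  refine (isEquivalent_iff_tendsto_one ?_).2 ?_
  · filter_upwards [eventually_gt_atTop 0] with r hr
    positivity
  have h2 := hlim.div_const (Real.sqrt Real.pi)
  rw [div_self hpi] at h2
  refine h2.congr' ?_
  filter_upwards [eventually_gt_atTop 0] with r hr
  simp only [Function.comp_apply, Pi.div_apply]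
  -- `s²` is the minimiser of `y + Cr/y`; `s⁴ = Cr` turns `y/r` into `(C/s²) e^{u/s}`.
  set s := (C * r) ^ (1 / 4 : ℝ) with hsdef
  have hs0 : 0 < s := by positivity
  have hs2 : s ^ 2 = Real.sqrt (C * r) := by
    rw [Real.sqrt_eq_rpow, hsdef, ← Real.rpow_natCast, ← Real.rpow_mul (by positivity)]
    norm_num
  have hs4 : s ^ 2 * s ^ 2 = C * r := by rw [hs2]; exact Real.mul_self_sqrt (by positivity)
  have hexp : Real.sqrt (4 * C * r) = 2 * s ^ 2 := by
    rw [hs2, mul_assoc, Real.sqrt_mul (by norm_num), show (4 : ℝ) = 2 ^ 2 by norm_num,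
      Real.sqrt_sq (by norm_num)]
  -- The factor `(C/s²)^b` is `t^b` at the saddle, and `s` is the width of the peak.
  have hpre : Real.sqrt (Real.pi * C ^ ((2 * b + 1) / 2)) * r ^ ((1 - 2 * b) / 4) =
      Real.sqrt Real.pi * (C / s ^ 2) ^ b * s := by
    have e1 : C / s ^ 2 = C ^ (1 / 2 : ℝ) * r ^ (-(1 / 2) : ℝ) := by
      rw [hs2, Real.sqrt_eq_rpow, Real.mul_rpow hC.le hr.le, Real.rpow_neg hr.le]
      have : C = C ^ (1 / 2 : ℝ) * C ^ (1 / 2 : ℝ) := by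
        rw [← Real.rpow_add hC]; norm_num
      nth_rewrite 1 [this]
      field_simp
    rw [e1, Real.sqrt_mul Real.pi_pos.le, Real.sqrt_eq_rpow (C ^ _), ← Real.rpow_mul hC.le,
      Real.mul_rpow (by positivity) (by positivity), ← Real.rpow_mul hC.le, ← Real.rpow_mul hr.le,
      hsdef, Real.mul_rpow hC.le hr.le]
    have e2 : C ^ ((2 * b + 1) / 2 * (1 / 2)) = C ^ (1 / 2 * b) * C ^ (1 / 4 : ℝ) := by
      rw [← Real.rpow_add hC]; congr 1; ring
    have e3 : r ^ ((1 - 2 * b) / 4) = r ^ (-(1 / 2) * b) * r ^ (1 / 4 : ℝ) := by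
      rw [← Real.rpow_add hr]; congr 1; ring
    rw [e2, e3]; ring
  rw [mul_assoc A, hpre, hexp,
    integral_Ioi_eq_integral_comp_mul_exp _ (show 0 < s ^ 2 by positivity) hs0,
    div_eq_div_iff hpi (by positivity)]
  have hint : ∀ u : ℝ, s ^ 2 * Real.exp (u / s) / s *
      (F (s ^ 2 * Real.exp (u / s) / r) * Real.exp (-(s ^ 2 * Real.exp (u / s)))) =
      (A * (C / s ^ 2) ^ b * s * Real.exp (-(2 * s ^ 2))) *
      (F (C / s ^ 2 * Real.exp (u / s)) / (A * (C / s ^ 2) ^ b) *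
      Real.exp (-s ^ 2 * Real.exp (u / s) + 2 * s ^ 2) * Real.exp (u / s)) := by
    intro u
    have e1 : s ^ 2 * Real.exp (u / s) / r = C / s ^ 2 * Real.exp (u / s) := by
      rw [div_mul_eq_mul_div, div_eq_div_iff hr.ne' (by positivity)]
      linear_combination Real.exp (u / s) * hs4
    have e2 : Real.exp (-s ^ 2 * Real.exp (u / s) + 2 * s ^ 2) =
        Real.exp (-(s ^ 2 * Real.exp (u / s))) * Real.exp (2 * s ^ 2) := by
      rw [← Real.exp_add]; congr 1; ring
    have e3 : Real.exp (-(2 * s ^ 2)) * Real.exp (2 * s ^ 2) = 1 := by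
      rw [← Real.exp_add]; simp
    rw [e1, e2]
    have : 0 < (C / s ^ 2) ^ b := by positivity
    generalize F (C / s ^ 2 * Real.exp (u / s)) = f
    generalize Real.exp (-(2 * s ^ 2)) = w at e3 ⊢
    generalize Real.exp (2 * s ^ 2) = z at e3 ⊢
    field_simp
    linear_combination (-f) * e3
  simp_rw [hint]
  rw [integral_const_mul]
  ring

/-! ### Moments of geometric sums -/

theorem lintegral_add_pow_of_indepFun {Ω : Type*} [MeasurableSpace Ω] {Q : Measure Ω}
    {f g : Ω → ℝ≥0∞} (hf : Measurable f) (hg : Measurable g) (h : IndepFun f g Q) (m : ℕ) :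
    ∫⁻ ω, (f ω + g ω) ^ m ∂Q = ∑ j ∈ Finset.range (m + 1),
      (m.choose j : ℝ≥0∞) * ((∫⁻ ω, f ω ^ j ∂Q) * ∫⁻ ω, g ω ^ (m - j) ∂Q) := by
  simp_rw [add_pow]
  rw [lintegral_finsetSum _ (fun j _ => by fun_prop)]
  refine Finset.sum_congr rfl fun j _ => ?_
  rw [lintegral_mul_const _ (by fun_prop), mul_comm]
  congr 1
  exact lintegral_mul_eq_lintegral_mul_lintegral_of_indepFun (f := fun ω => f ω ^ j)
    (g := fun ω => g ω ^ (m - j)) (by fun_prop) (by fun_prop)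
    (h.comp (φ := fun x : ℝ≥0∞ => x ^ j) (ψ := fun x : ℝ≥0∞ => x ^ (m - j))
      (by fun_prop) (by fun_prop))

theorem sum_range_succ_multichoose (n k : ℕ) :
    ∑ j ∈ Finset.range (k + 1), n.multichoose j = (n + 1).multichoose k := by
  induction k with
  | zero => simp
  | succ k ih => rw [Finset.sum_range_succ, ih, Nat.multichoose_succ_succ, add_comm]

/-- Moments of a sum of independent variables whose moments are at most those of an exponential
variable with mean `a`. -/
theorem lintegral_sum_range_pow_le {Ω : Type*} [MeasurableSpace Ω] {Q : Measure Ω}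
    [IsProbabilityMeasure Q] {X : ℕ → Ω → ℝ≥0∞} (hX : ∀ n, Measurable (X n))
    (hind : iIndepFun X Q) {a : ℝ≥0∞}
    (hm : ∀ n k, ∫⁻ ω, X n ω ^ k ∂Q ≤ (k.factorial : ℝ≥0∞) * a ^ k) (n k : ℕ) :
    ∫⁻ ω, (∑ i ∈ Finset.range n, X i ω) ^ k ∂Q ≤
      (k.factorial : ℝ≥0∞) * (n.multichoose k : ℝ≥0∞) * a ^ k := by
  induction n generalizing k with
  | zero => cases k <;> simp
  | succ n ih =>
    simp_rw [Finset.sum_range_succ]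
    have hi : IndepFun (fun ω => ∑ i ∈ Finset.range n, X i ω) (X n) Q := by
      have := hind.indepFun_finsetSum_of_notMem hX (Finset.notMem_range_self (n := n))
      convert this using 1
      ext ω; simp
    rw [lintegral_add_pow_of_indepFun (by fun_prop) (hX n) hi]
    calc _ ≤ ∑ j ∈ Finset.range (k + 1), (k.choose j : ℝ≥0∞) *
          (((j.factorial : ℝ≥0∞) * (n.multichoose j : ℝ≥0∞) * a ^ j) *
          (((k - j).factorial : ℝ≥0∞) * a ^ (k - j))) := by
          gcongr with j hj
          · exact ih j
          · exact hm n (k - j)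
      -- The identity `(k choose j) j! (k-j)! = k!` removes all factorials that depend on `j`,
      -- leaving a sum of multiset coefficients.
      _ = ∑ j ∈ Finset.range (k + 1), (k.factorial : ℝ≥0∞) * (n.multichoose j : ℝ≥0∞) * a ^ k := by
          refine Finset.sum_congr rfl fun j hj => ?_
          have hjk : j ≤ k := Nat.lt_succ_iff.1 (Finset.mem_range.1 hj)
          have h1 : a ^ k = a ^ j * a ^ (k - j) := by rw [← pow_add, Nat.add_sub_cancel' hjk]
          rw [← Nat.choose_mul_factorial_mul_factorial hjk, h1]
          push_cast; ring
      _ = _ := by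
          rw [← Finset.sum_mul, ← Finset.mul_sum, ← Nat.cast_sum, sum_range_succ_multichoose]

theorem lintegral_comp_nat_of_indepFun {Ω : Type*} [MeasurableSpace Ω] {Q : Measure Ω}
    {R : Ω → ℕ} (hR : Measurable R) {G : ℕ → Ω → ℝ≥0∞} (hG : ∀ n, Measurable (G n))
    (hind : ∀ n, IndepFun R (G n) Q) :
    ∫⁻ ω, G (R ω) ω ∂Q = ∑' n, Q {ω | R ω = n} * ∫⁻ ω, G n ω ∂Q := by
  have h1 : ∀ ω, G (R ω) ω = ∑' n, ({n} : Set ℕ).indicator 1 (R ω) * G n ω := by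
    intro ω
    rw [tsum_eq_single (R ω)]
    · simp
    · intro n hn
      simp [hn.symm]
  simp_rw [h1]
  have hm : ∀ n, Measurable fun ω => ({n} : Set ℕ).indicator (1 : ℕ → ℝ≥0∞) (R ω) := fun n =>
    (measurable_of_countable (({n} : Set ℕ).indicator (1 : ℕ → ℝ≥0∞))).comp hR
  rw [lintegral_tsum (f := fun n ω => ({n} : Set ℕ).indicator (1 : ℕ → ℝ≥0∞) (R ω) * G n ω)
    fun n => ((hm n).mul (hG n)).aemeasurable]
  refine tsum_congr fun n => ?_
  have h2 := lintegral_mul_eq_lintegral_mul_lintegral_of_indepFun (hm n) (hG n)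
    ((hind n).comp (φ := ({n} : Set ℕ).indicator (1 : ℕ → ℝ≥0∞)) (ψ := id)
      (measurable_of_countable _) measurable_id)
  simp only [Pi.mul_apply] at h2
  rw [h2]
  congr 1
  have h3 : (fun ω => ({n} : Set ℕ).indicator (1 : ℕ → ℝ≥0∞) (R ω)) =
      (R ⁻¹' {n}).indicator 1 := by
    rfl
  rw [h3, lintegral_indicator_one (hR (measurableSet_singleton n))]
  rfl

theorem pow_lintegral_le_lintegral_pow {Ω : Type*} [MeasurableSpace Ω] {Q : Measure Ω}
    [IsProbabilityMeasure Q] {f : Ω → ℝ≥0∞} (hf : Measurable f) {m : ℕ} (hm : 1 ≤ m) :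
    (∫⁻ ω, f ω ∂Q) ^ m ≤ ∫⁻ ω, f ω ^ m ∂Q := by
  have hm0 : (0 : ℝ) < m := by exact_mod_cast hm
  have h := eLpNorm'_le_eLpNorm'_of_exponent_le (μ := Q) (f := f) (p := 1) (q := m) one_pos
    (by exact_mod_cast hm) hf.aestronglyMeasurable
  simp only [eLpNorm', enorm_eq_self, ENNReal.rpow_one, ENNReal.rpow_natCast, div_one] at h
  calc (∫⁻ ω, f ω ∂Q) ^ m ≤ ((∫⁻ ω, f ω ^ m ∂Q) ^ (1 / (m : ℝ))) ^ m := by gcongr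
    _ = _ := by
      rw [← ENNReal.rpow_natCast, ← ENNReal.rpow_mul, one_div_mul_cancel hm0.ne', ENNReal.rpow_one]

/-- Negative binomial series: `∑ (n+k choose k) q^n = (1-q)^{-(k+1)}` at `q = 1 - p`. -/
theorem tsum_ofReal_geometric_mul_choose {p : ℝ} (hp0 : 0 < p) (hp1 : p ≤ 1) (k : ℕ) :
    ∑' n : ℕ, ENNReal.ofReal ((1 - p) ^ n * p) * ((n + k).choose k : ℝ≥0∞) =
      ENNReal.ofReal (1 / p ^ k) := by
  have hs := (hasSum_choose_mul_geometric_of_norm_lt_one k (r := 1 - p)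
    (by rw [Real.norm_of_nonneg (by linarith)]; linarith)).mul_right p
  have hq : 0 ≤ 1 - p := by linarith
  have h1 : ∀ n : ℕ, ENNReal.ofReal ((1 - p) ^ n * p) * ((n + k).choose k : ℝ≥0∞) =
      ENNReal.ofReal (((n + k).choose k : ℝ) * (1 - p) ^ n * p) := by
    intro n
    rw [mul_assoc, mul_comm, ENNReal.ofReal_mul (Nat.cast_nonneg _), ENNReal.ofReal_natCast]
  simp_rw [h1]
  rw [← ENNReal.ofReal_tsum_of_nonneg (fun n => by positivity) hs.summable, hs.tsum_eq]
  congr 1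
  rw [sub_sub_cancel, pow_succ]
  field_simp

/-- Brings the multiset coefficient into the form of the negative binomial series. For `k ≥ 1` the
geometric average loses only a factor `1 - p`, harmless as `p → 0`. -/
theorem multichoose_le_choose (n k : ℕ) : n.multichoose k ≤ (n + k).choose k := by
  rw [Nat.multichoose_eq]
  exact Nat.choose_le_choose k (Nat.sub_le _ _)

/-- A geometric sum of independent variables plus an independent remainder: upper bound on the
moments. -/
theorem lintegral_geometric_sum_pow_le {Ω : Type*} [MeasurableSpace Ω] {Q : Measure Ω}
    [IsProbabilityMeasure Q] {R : Ω → ℕ} {X : ℕ → Ω → ℝ≥0∞} {Z : Ω → ℝ≥0∞}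
    (hR : Measurable R) (hX : ∀ n, Measurable (X n)) (hZ : Measurable Z)
    (hiX : iIndepFun X Q) (hiZ : IndepFun (fun ω n => X n ω) Z Q)
    (hiR : IndepFun R (fun ω => ((fun n => X n ω), Z ω)) Q)
    {p : ℝ} (hp0 : 0 < p) (hp1 : p ≤ 1)
    (hgeo : ∀ n : ℕ, Q {ω | R ω = n} = ENNReal.ofReal ((1 - p) ^ n * p)) {a : ℝ≥0∞}
    (hm : ∀ n k, ∫⁻ ω, X n ω ^ k ∂Q ≤ (k.factorial : ℝ≥0∞) * a ^ k) (m : ℕ) :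
    ∫⁻ ω, ((∑ i ∈ Finset.range (R ω), X i ω) + Z ω) ^ m ∂Q ≤
      ∑ j ∈ Finset.range (m + 1), (m.choose j : ℝ≥0∞) * (j.factorial : ℝ≥0∞) * a ^ j *
        ENNReal.ofReal (1 / p ^ j) * ∫⁻ ω, Z ω ^ (m - j) ∂Q := by
  rw [lintegral_comp_nat_of_indepFun (G := fun n ω => ((∑ i ∈ Finset.range n, X i ω) + Z ω) ^ m)
    hR (fun n => by fun_prop)
    (fun n => hiR.comp (φ := id)
      (ψ := fun z : (ℕ → ℝ≥0∞) × ℝ≥0∞ => ((∑ i ∈ Finset.range n, z.1 i) + z.2) ^ m)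
      measurable_id (by fun_prop))]
  have h1 : ∀ n : ℕ, ∫⁻ ω, ((∑ i ∈ Finset.range n, X i ω) + Z ω) ^ m ∂Q ≤
      ∑ j ∈ Finset.range (m + 1), (m.choose j : ℝ≥0∞) *
        (((j.factorial : ℝ≥0∞) * ((n + j).choose j : ℝ≥0∞) * a ^ j) *
          ∫⁻ ω, Z ω ^ (m - j) ∂Q) := by
    intro n
    rw [lintegral_add_pow_of_indepFun (f := fun ω => ∑ i ∈ Finset.range n, X i ω)
      (by fun_prop) hZ (hiZ.comp (φ := fun x : ℕ → ℝ≥0∞ => ∑ i ∈ Finset.range n, x i) (ψ := id)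
        (by fun_prop) measurable_id)]
    gcongr with j hj
    refine (lintegral_sum_range_pow_le hX hiX hm n j).trans ?_
    gcongr
    exact multichoose_le_choose n j
  calc _ ≤ ∑' n : ℕ, ∑ j ∈ Finset.range (m + 1), ((m.choose j : ℝ≥0∞) * (j.factorial : ℝ≥0∞) *
        a ^ j * ∫⁻ ω, Z ω ^ (m - j) ∂Q) *
        (ENNReal.ofReal ((1 - p) ^ n * p) * ((n + j).choose j : ℝ≥0∞)) := by
        refine ENNReal.tsum_le_tsum fun n => ?_
        rw [hgeo n]
        refine (mul_le_mul_right (h1 n) _).trans_eq ?_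
        rw [Finset.mul_sum]
        exact Finset.sum_congr rfl fun j _ => by ring
    _ = _ := by
        rw [Summable.tsum_finsetSum fun _ _ => ENNReal.summable]
        refine Finset.sum_congr rfl fun j _ => ?_
        rw [ENNReal.tsum_mul_left, tsum_ofReal_geometric_mul_choose hp0 hp1]
        ring

/-- A geometric sum of independent variables: lower bound on the moments. -/
theorem le_lintegral_geometric_sum_pow {Ω : Type*} [MeasurableSpace Ω] {Q : Measure Ω}
    [IsProbabilityMeasure Q] {R : Ω → ℕ} {X : ℕ → Ω → ℝ≥0∞} {Z : Ω → ℝ≥0∞}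
    (hR : Measurable R) (hX : ∀ n, Measurable (X n)) (hZ : Measurable Z)
    (hiR : IndepFun R (fun ω => ((fun n => X n ω), Z ω)) Q)
    {p : ℝ} (hp0 : 0 < p) (hp1 : p ≤ 1)
    (hgeo : ∀ n : ℕ, Q {ω | R ω = n} = ENNReal.ofReal ((1 - p) ^ n * p)) {μ : ℝ≥0∞}
    (hμ : ∀ n, μ ≤ ∫⁻ ω, X n ω ∂Q) {m : ℕ} (hm : 1 ≤ m) :
    μ ^ m * (m.factorial : ℝ≥0∞) * ENNReal.ofReal ((1 - p) ^ m / p ^ m) ≤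
      ∫⁻ ω, ((∑ i ∈ Finset.range (R ω), X i ω) + Z ω) ^ m ∂Q := by
  rw [lintegral_comp_nat_of_indepFun (G := fun n ω => ((∑ i ∈ Finset.range n, X i ω) + Z ω) ^ m)
    hR (fun n => by fun_prop)
    (fun n => hiR.comp (φ := id)
      (ψ := fun z : (ℕ → ℝ≥0∞) × ℝ≥0∞ => ((∑ i ∈ Finset.range n, z.1 i) + z.2) ^ m)
      measurable_id (by fun_prop))]
  have h1 : ∀ n : ℕ, (n * μ) ^ m ≤ ∫⁻ ω, ((∑ i ∈ Finset.range n, X i ω) + Z ω) ^ m ∂Q := by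
    intro n
    calc ((n : ℝ≥0∞) * μ) ^ m ≤ (∫⁻ ω, ∑ i ∈ Finset.range n, X i ω ∂Q) ^ m := by
          gcongr
          rw [lintegral_finsetSum _ fun i _ => hX i]
          calc (n : ℝ≥0∞) * μ = ∑ i ∈ Finset.range n, μ := by simp
            _ ≤ _ := Finset.sum_le_sum fun i _ => hμ i
      _ ≤ ∫⁻ ω, (∑ i ∈ Finset.range n, X i ω) ^ m ∂Q :=
          pow_lintegral_le_lintegral_pow (by fun_prop) hm
      _ ≤ _ := by
          gcongr
          exact le_self_add
  have hq : 0 ≤ 1 - p := by linarith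
  -- The terms with `R < m` are dropped. Writing `R = k + m` produces the factor `(1-p)^m`, and
  -- `(k+m)^m ≥ m! (k+m choose m)` reduces the rest to the negative binomial series.
  calc μ ^ m * (m.factorial : ℝ≥0∞) * ENNReal.ofReal ((1 - p) ^ m / p ^ m)
      = ∑' k : ℕ, μ ^ m * (m.factorial : ℝ≥0∞) * ENNReal.ofReal ((1 - p) ^ m) *
          (ENNReal.ofReal ((1 - p) ^ k * p) * ((k + m).choose m : ℝ≥0∞)) := by
        rw [ENNReal.tsum_mul_left, tsum_ofReal_geometric_mul_choose hp0 hp1, mul_assoc _ _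
          (ENNReal.ofReal (1 / p ^ m)), ← ENNReal.ofReal_mul (by positivity), mul_one_div]
    _ ≤ ∑' k : ℕ, Q {ω | R ω = k + m} *
          ∫⁻ ω, ((∑ i ∈ Finset.range (k + m), X i ω) + Z ω) ^ m ∂Q := by
        refine ENNReal.tsum_le_tsum fun k => ?_
        have h2 := h1 (k + m)
        have h3 : ((m.factorial : ℝ≥0∞) * ((k + m).choose m : ℝ≥0∞)) ≤ ((k + m : ℕ) : ℝ≥0∞) ^ m := by
          rw [← Nat.cast_mul, ← Nat.descFactorial_eq_factorial_mul_choose, ← Nat.cast_pow]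
          exact_mod_cast Nat.descFactorial_le_pow _ _
        have h4 : ENNReal.ofReal ((1 - p) ^ (k + m) * p) =
            ENNReal.ofReal ((1 - p) ^ m) * ENNReal.ofReal ((1 - p) ^ k * p) := by
          rw [← ENNReal.ofReal_mul (by positivity)]; congr 1; ring
        rw [hgeo (k + m), h4]
        calc _ = ENNReal.ofReal ((1 - p) ^ m) * ENNReal.ofReal ((1 - p) ^ k * p) *
              (((m.factorial : ℝ≥0∞) * ((k + m).choose m : ℝ≥0∞)) * μ ^ m) := by ring
          _ ≤ ENNReal.ofReal ((1 - p) ^ m) * ENNReal.ofReal ((1 - p) ^ k * p) *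
              (((k + m : ℕ) : ℝ≥0∞) ^ m * μ ^ m) := by gcongr
          _ ≤ _ := by
              rw [← mul_pow]
              gcongr
    _ ≤ _ := ENNReal.tsum_comp_le_tsum_of_injective (add_left_injective m)
        (fun n => Q {ω | R ω = n} * ∫⁻ ω, ((∑ i ∈ Finset.range n, X i ω) + Z ω) ^ m ∂Q)

/-! ### The exponential law and laws determined by survival functions -/

theorem measurable_coe_ereal_div (r : ℝ) : Measurable fun y : ℝ => ((y / r : ℝ) : EReal) :=
  measurable_coe_real_ereal.comp (measurable_id.div_const r)

theorem expMeasure_one_eq :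
    expMeasure 1 = (volume.restrict (Set.Ioi 0)).withDensity
      fun y : ℝ => ENNReal.ofReal (Real.exp (-y)) := by
  rw [← withDensity_indicator measurableSet_Ioi]
  refine withDensity_congr_ae ?_
  have h0 : ∀ᵐ y : ℝ, y ≠ 0 := by simp [ae_iff]
  filter_upwards [h0] with y hy
  change exponentialPDF 1 y = _
  rw [exponentialPDF_eq]
  rcases lt_or_gt_of_ne hy with h | h
  · simp [not_le.2 h, h.le]
  · simp [h, h.le]

theorem lintegral_expMeasure_one {f : ℝ → ℝ≥0∞} (hf : Measurable f) :
    ∫⁻ y, f y ∂(expMeasure 1) =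
      ∫⁻ y in Set.Ioi 0, ENNReal.ofReal (Real.exp (-y)) * f y := by
  rw [expMeasure_one_eq, lintegral_withDensity_eq_lintegral_mul _ (by fun_prop) hf]
  rfl

theorem lintegral_expMeasure_one_pow (k : ℕ) :
    ∫⁻ y, ENNReal.ofReal y ^ k ∂(expMeasure 1) = (k.factorial : ℝ≥0∞) := by
  rw [lintegral_expMeasure_one (by fun_prop)]
  have hk : (0 : ℝ) < (k : ℝ) + 1 := by positivity
  have h1 : ∫⁻ y in Set.Ioi (0 : ℝ), ENNReal.ofReal (Real.exp (-y)) * ENNReal.ofReal y ^ k =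
      ∫⁻ y in Set.Ioi (0 : ℝ), ENNReal.ofReal (Real.exp (-y) * y ^ ((k : ℝ) + 1 - 1)) := by
    refine setLIntegral_congr_fun measurableSet_Ioi fun y hy => ?_
    have hy0 : (0 : ℝ) < y := hy
    rw [add_sub_cancel_right, Real.rpow_natCast, ENNReal.ofReal_mul (Real.exp_pos _).le,
      ENNReal.ofReal_pow hy0.le]
  rw [h1, ← ofReal_integral_eq_lintegral_ofReal (Real.GammaIntegral_convergent hk),
    ← Real.Gamma_eq_integral hk, Real.Gamma_nat_eq_factorial, ENNReal.ofReal_natCast]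
  filter_upwards [self_mem_ae_restrict measurableSet_Ioi] with y hy
  have hy0 : (0 : ℝ) < y := hy
  positivity

theorem map_eq_expMeasure_one {Ω : Type*} [MeasurableSpace Ω] {P : Measure Ω}
    [IsProbabilityMeasure P] {Y : Ω → ℝ} (hYm : Measurable Y) (hY : IsUnitExponential P Y) :
    P.map Y = expMeasure 1 := by
  have := isProbabilityMeasure_expMeasure one_pos
  have : IsProbabilityMeasure (P.map Y) := Measure.isProbabilityMeasure_map hYm.aemeasurable
  have hnn : ∀ x : ℝ, 0 ≤ x → cdf (P.map Y) x = 1 - Real.exp (-x) := by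
    intro x hx
    have h2 := probReal_compl_eq_one_sub (μ := P) (measurableSet_lt measurable_const hYm :
      MeasurableSet {ω | x < Y ω})
    rw [hY x hx] at h2
    rw [cdf_eq_real, map_measureReal_apply hYm measurableSet_Iic, ← h2]
    congr 1
    ext ω; simp
  refine Measure.eq_of_cdf _ _ ?_
  ext x
  rw [cdf_expMeasure_eq one_pos]
  split_ifs with hx
  · rw [hnn x hx, one_mul]
  -- The survival hypothesis covers only `y ≥ 0`; for negative arguments monotonicity and the value
  -- `0` at `0` suffice.
  · refine le_antisymm ?_ (cdf_nonneg _ _)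
    have := monotone_cdf (P.map Y) (not_le.1 hx).le
    rwa [hnn 0 le_rfl, neg_zero, Real.exp_zero, sub_self] at this

theorem map_eq_map_of_survival {Ω Ω' : Type*} [MeasurableSpace Ω] [MeasurableSpace Ω']
    {P : Measure Ω} {Q : Measure Ω'} [IsProbabilityMeasure P] [IsProbabilityMeasure Q]
    {X : Ω → ℝ} {X' : Ω' → ℝ} (hX : Measurable X) (hX' : Measurable X')
    (h : ∀ t, P.real {ω | t < X ω} = Q.real {ω | t < X' ω}) : P.map X = Q.map X' := by
  have : IsProbabilityMeasure (P.map X) := Measure.isProbabilityMeasure_map hX.aemeasurable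
  have : IsProbabilityMeasure (Q.map X') := Measure.isProbabilityMeasure_map hX'.aemeasurable
  refine Measure.eq_of_cdf _ _ ?_
  ext x
  have h1 := probReal_compl_eq_one_sub (μ := P) (measurableSet_lt measurable_const hX :
      MeasurableSet {ω | x < X ω})
  have h2 := probReal_compl_eq_one_sub (μ := Q) (measurableSet_lt measurable_const hX' :
      MeasurableSet {ω | x < X' ω})
  rw [h x, ← h2] at h1
  rw [cdf_eq_real, cdf_eq_real, map_measureReal_apply hX measurableSet_Iic,
    map_measureReal_apply hX' measurableSet_Iic]
  convert h1 using 2 <;> · ext ω; simp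

/-! ### Success and failure events for large `r` -/

section Search

variable {Ω : Type*} [MeasurableSpace Ω] {P : Measure Ω} {τ : Ω → EReal} {Y : Ω → ℝ}

theorem measurableSet_successEvent (h : IsSearchWithResetting P τ Y) (r : ℝ) :
    MeasurableSet (successEvent τ Y r) :=
  measurableSet_lt h.measurable_search ((measurable_coe_ereal_div r).comp h.measurable_reset)

theorem measurableSet_failureEvent (h : IsSearchWithResetting P τ Y) (r : ℝ) :
    MeasurableSet (failureEvent τ Y r) :=
  measurableSet_lt ((measurable_coe_ereal_div r).comp h.measurable_reset) h.measurable_search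

variable [IsProbabilityMeasure P]

theorem ae_search_pos (h : IsSearchWithResetting P τ Y) : ∀ᵐ ω ∂P, 0 < τ ω := by
  have h0 := h.cdf_zero
  rw [searchCDF, measureReal_eq_zero_iff] at h0
  rw [ae_iff]
  simpa using h0

theorem ae_reset_pos (h : IsSearchWithResetting P τ Y) (hY : IsUnitExponential P Y) :
    ∀ᵐ ω ∂P, 0 < Y ω := by
  have h1 := hY 0 le_rfl
  rw [neg_zero, Real.exp_zero] at h1
  have h2 := probReal_compl_eq_one_sub (μ := P)
    (measurableSet_lt measurable_const h.measurable_reset : MeasurableSet {ω | 0 < Y ω})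
  rw [h1, sub_self, measureReal_eq_zero_iff] at h2
  exact h2

theorem lintegral_reset_pow (h : IsSearchWithResetting P τ Y) (hY : IsUnitExponential P Y)
    (k : ℕ) : ∫⁻ ω, ENNReal.ofReal (Y ω) ^ k ∂P = (k.factorial : ℝ≥0∞) := by
  rw [← lintegral_expMeasure_one_pow, ← map_eq_expMeasure_one h.measurable_reset hY,
    lintegral_map (by fun_prop) h.measurable_reset]

theorem map_search_reset_eq_prod (h : IsSearchWithResetting P τ Y) (hY : IsUnitExponential P Y) :
    P.map (fun ω => (τ ω, Y ω)) = (P.map τ).prod (expMeasure 1) := by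
  rw [← map_eq_expMeasure_one h.measurable_reset hY]
  exact (indepFun_iff_map_prod_eq_prod_map_map h.measurable_search.aemeasurable
    h.measurable_reset.aemeasurable).1 h.indep

/-- By Fubini: each fixed value of `τ` is met by at most one value of `Y`, and the law of `Y` has no
atoms. -/
theorem measure_search_eq_resetTime (h : IsSearchWithResetting P τ Y)
    (hY : IsUnitExponential P Y) {r : ℝ} (hr : 0 < r) :
    P {ω | τ ω = (resetTime Y r ω : EReal)} = 0 := by
  have hm : MeasurableSet {z : EReal × ℝ | z.1 = ((z.2 / r : ℝ) : EReal)} :=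
    measurableSet_eq_fun measurable_fst ((measurable_coe_ereal_div r).comp measurable_snd)
  have h1 : P {ω | τ ω = (resetTime Y r ω : EReal)} =
      P.map (fun ω => (τ ω, Y ω)) {z : EReal × ℝ | z.1 = ((z.2 / r : ℝ) : EReal)} := by
    rw [Measure.map_apply (h.measurable_search.prodMk h.measurable_reset) hm]
    rfl
  have := isProbabilityMeasure_expMeasure one_pos
  rw [h1, map_search_reset_eq_prod h hY, Measure.measure_prod_null hm]
  refine Eventually.of_forall fun t => ?_
  have hac : expMeasure 1 ≪ volume := withDensity_absolutelyContinuous _ _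
  refine hac (Set.Subsingleton.measure_zero ?_ _)
  intro y hy z hz
  have hyz : ((y / r : ℝ) : EReal) = ((z / r : ℝ) : EReal) := Eq.trans (Eq.symm hy) hz
  have := EReal.coe_injective hyz
  field_simp at this
  exact this

theorem monotone_searchCDF : Monotone (searchCDF P τ) := by
  intro s t hst
  refine measureReal_mono fun ω hω => ?_
  exact le_trans (show τ ω ≤ (s : EReal) from hω) (EReal.coe_le_coe_iff.2 hst)

/-- Ties are null, so `<` may be replaced by `≤`; integrating out `τ` first then gives its
distribution function. -/
theorem successProb_eq_integral (h : IsSearchWithResetting P τ Y)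
    (hY : IsUnitExponential P Y) {r : ℝ} (hr : 0 < r) :
    successProb P τ Y r = ∫ y in Set.Ioi 0, searchCDF P τ (y / r) * Real.exp (-y) := by
  have := isProbabilityMeasure_expMeasure one_pos
  have : IsProbabilityMeasure (P.map τ) :=
    Measure.isProbabilityMeasure_map h.measurable_search.aemeasurable
  have hm : MeasurableSet {z : EReal × ℝ | z.1 ≤ ((z.2 / r : ℝ) : EReal)} :=
    measurableSet_le measurable_fst ((measurable_coe_ereal_div r).comp measurable_snd)
  have hF : Measurable (searchCDF P τ) := monotone_searchCDF.measurable
  have h1 : P (successEvent τ Y r) = P {ω | τ ω ≤ (resetTime Y r ω : EReal)} := by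
    refine measure_congr ?_
    have h2 : ∀ᵐ ω ∂P, ¬ τ ω = (resetTime Y r ω : EReal) := by
      rw [ae_iff]; simpa using measure_search_eq_resetTime h hY hr
    filter_upwards [h2] with ω hω
    exact propext ⟨fun h => le_of_lt h, fun h => lt_of_le_of_ne h hω⟩
  have h3 : P {ω | τ ω ≤ (resetTime Y r ω : EReal)} =
      P.map (fun ω => (τ ω, Y ω)) {z : EReal × ℝ | z.1 ≤ ((z.2 / r : ℝ) : EReal)} := by
    rw [Measure.map_apply (h.measurable_search.prodMk h.measurable_reset) hm]
    rfl
  have h4 : ∀ y : ℝ, P.map τ ((fun t => (t, y)) ⁻¹' {z : EReal × ℝ | z.1 ≤ ((z.2 / r : ℝ) : EReal)})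
      = ENNReal.ofReal (searchCDF P τ (y / r)) := by
    intro y
    rw [Measure.map_apply h.measurable_search (measurable_prodMk_right hm), searchCDF,
      ofReal_measureReal]
    rfl
  have h5 : P (successEvent τ Y r) = ∫⁻ y in Set.Ioi 0,
      ENNReal.ofReal (searchCDF P τ (y / r) * Real.exp (-y)) := by
    rw [h1, h3, map_search_reset_eq_prod h hY, Measure.prod_apply_symm hm]
    simp_rw [h4]
    rw [lintegral_expMeasure_one (by fun_prop)]
    refine lintegral_congr fun y => ?_
    rw [← ENNReal.ofReal_mul (Real.exp_pos _).le, mul_comm]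
  rw [successProb, measureReal_def, h5, integral_eq_lintegral_of_nonneg_ae]
  · exact Eventually.of_forall fun y =>
      mul_nonneg measureReal_nonneg (Real.exp_pos _).le
  · exact (by fun_prop : Measurable _).aestronglyMeasurable

theorem successProb_isEquivalent (h : IsSearchWithResetting P τ Y)
    (hY : IsUnitExponential P Y) {A C b : ℝ} (hA : 0 < A) (hC : 0 < C)
    (hF : (fun t : ℝ => searchCDF P τ t) ~[𝓝[>] 0]
      (fun t : ℝ => A * t ^ b * Real.exp (-C / t))) :
    (fun r : ℝ => successProb P τ Y r) ~[atTop]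
      (fun r : ℝ => A * Real.sqrt (Real.pi * C ^ ((2 * b + 1) / 2)) * r ^ ((1 - 2 * b) / 4) *
        Real.exp (-Real.sqrt (4 * C * r))) := by
  refine (laplace_isEquivalent monotone_searchCDF.measurable (fun t => measureReal_nonneg)
    (fun t => measureReal_le_one) hA hC hF).congr_left ?_
  filter_upwards [eventually_gt_atTop 0] with r hr
  exact (successProb_eq_integral h hY hr).symm

theorem eventually_resetTime_lt_search (h : IsSearchWithResetting P τ Y) :
    ∀ᵐ ω ∂P, ∀ᶠ r in atTop, ω ∈ failureEvent τ Y r ∧ ω ∉ successEvent τ Y r := by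
  filter_upwards [ae_search_pos h] with ω hω
  have ht : Tendsto (fun r : ℝ => ((Y ω / r : ℝ) : EReal)) atTop (𝓝 ((0 : ℝ) : EReal)) :=
    (continuous_coe_real_ereal.tendsto 0).comp (tendsto_const_nhds.div_atTop tendsto_id)
  filter_upwards [ht.eventually_lt_const (show ((0 : ℝ) : EReal) < τ ω from hω)] with r hr
  exact ⟨hr, not_lt.2 hr.le⟩

/-- Dominated convergence with majorant `Y^k`, as almost every outcome eventually leaves the success
event. The case `k = 0` is the convergence of its probability. -/
theorem tendsto_setLIntegral_successEvent (h : IsSearchWithResetting P τ Y)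
    (hY : IsUnitExponential P Y) (k : ℕ) :
    Tendsto (fun r => ∫⁻ ω in successEvent τ Y r, ENNReal.ofReal (Y ω) ^ k ∂P) atTop (𝓝 0) := by
  have hYm := h.measurable_reset
  have h1 := tendsto_lintegral_filter_of_dominated_convergence (μ := P) (l := atTop)
    (F := fun (r : ℝ) ω => (successEvent τ Y r).indicator (fun ω => ENNReal.ofReal (Y ω) ^ k) ω)
    (f := fun _ => 0) (fun ω => ENNReal.ofReal (Y ω) ^ k)
    (Eventually.of_forall fun r => Measurable.indicator (by fun_prop)
      (measurableSet_successEvent h r))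
    (Eventually.of_forall fun r => Eventually.of_forall fun ω => Set.indicator_le_self _ _ ω)
    (by rw [lintegral_reset_pow h hY]; exact ENNReal.natCast_ne_top _)
    (by
      filter_upwards [eventually_resetTime_lt_search h] with ω hω
      refine tendsto_const_nhds.congr' ?_
      filter_upwards [hω] with r hr
      rw [Set.indicator_of_notMem hr.2])
  simp only [lintegral_zero] at h1
  refine h1.congr fun r => ?_
  rw [lintegral_indicator (measurableSet_successEvent h r)]

theorem tendsto_setLIntegral_failureEvent (h : IsSearchWithResetting P τ Y)
    (hY : IsUnitExponential P Y) (k : ℕ) :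
    Tendsto (fun r => ∫⁻ ω in failureEvent τ Y r, ENNReal.ofReal (Y ω) ^ k ∂P) atTop
      (𝓝 (k.factorial : ℝ≥0∞)) := by
  have hYm := h.measurable_reset
  have h1 := tendsto_lintegral_filter_of_dominated_convergence (μ := P) (l := atTop)
    (F := fun (r : ℝ) ω => (failureEvent τ Y r).indicator (fun ω => ENNReal.ofReal (Y ω) ^ k) ω)
    (f := fun ω => ENNReal.ofReal (Y ω) ^ k) (fun ω => ENNReal.ofReal (Y ω) ^ k)
    (Eventually.of_forall fun r => Measurable.indicator (by fun_prop)
      (measurableSet_failureEvent h r))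
    (Eventually.of_forall fun r => Eventually.of_forall fun ω => Set.indicator_le_self _ _ ω)
    (by rw [lintegral_reset_pow h hY]; exact ENNReal.natCast_ne_top _)
    (by
      filter_upwards [eventually_resetTime_lt_search h] with ω hω
      refine tendsto_const_nhds.congr' ?_
      filter_upwards [hω] with r hr
      rw [Set.indicator_of_mem hr.1])
  rw [lintegral_reset_pow h hY] at h1
  refine h1.congr fun r => ?_
  rw [lintegral_indicator (measurableSet_failureEvent h r)]

end Search

/-! ### Transfer of conditional laws -/

theorem map_eq_map_cond_of_survival {Ω Ω' : Type*} [MeasurableSpace Ω] [MeasurableSpace Ω']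
    {P : Measure Ω} {Q : Measure Ω'} [IsProbabilityMeasure P] [IsProbabilityMeasure Q]
    {X : Ω → ℝ} {X' : Ω' → ℝ} (hX : Measurable X) (hX' : Measurable X') {E : Set Ω}
    (hE : P E ≠ 0) (h : ∀ t, Q.real {ω | t < X' ω} = (cond P E).real {ω | t < X ω}) :
    Q.map X' = (cond P E).map X := by
  have := cond_isProbabilityMeasure (μ := P) hE
  exact map_eq_map_of_survival hX' hX h

theorem lintegral_comp_of_survival {Ω Ω' : Type*} [MeasurableSpace Ω] [MeasurableSpace Ω']
    {P : Measure Ω} {Q : Measure Ω'} [IsProbabilityMeasure P] [IsProbabilityMeasure Q]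
    {X : Ω → ℝ} {X' : Ω' → ℝ} (hX : Measurable X) (hX' : Measurable X') {E : Set Ω}
    (hE : P E ≠ 0) (h : ∀ t, Q.real {ω | t < X' ω} = (cond P E).real {ω | t < X ω})
    {g : ℝ → ℝ≥0∞} (hg : Measurable g) :
    ∫⁻ ω, g (X' ω) ∂Q = (P E)⁻¹ * ∫⁻ ω in E, g (X ω) ∂P := by
  rw [← lintegral_map hg hX', map_eq_map_cond_of_survival hX hX' hE h, lintegral_map hg hX,
    ProbabilityTheory.cond, lintegral_smul_measure, smul_eq_mul]

theorem ae_nonneg_of_survival {Ω Ω' : Type*} [MeasurableSpace Ω] [MeasurableSpace Ω']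
    {P : Measure Ω} {Q : Measure Ω'} [IsProbabilityMeasure P] [IsProbabilityMeasure Q]
    {X : Ω → ℝ} {X' : Ω' → ℝ} (hX : Measurable X) (hX' : Measurable X') {E : Set Ω}
    (hE : P E ≠ 0) (h : ∀ t, Q.real {ω | t < X' ω} = (cond P E).real {ω | t < X ω})
    (hnn : ∀ᵐ ω ∂P, 0 ≤ X ω) : ∀ᵐ ω ∂Q, 0 ≤ X' ω := by
  have hm : MeasurableSet {x : ℝ | 0 ≤ x} := measurableSet_Ici
  rw [← ae_map_iff hX'.aemeasurable hm, map_eq_map_cond_of_survival hX hX' hE h,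
    ae_map_iff hX.aemeasurable hm]
  exact cond_absolutelyContinuous.ae_le hnn

/-! ### Two-sided bounds on the scaled moments of `T` -/

section Decomposition

variable {Ω : Type*} [MeasurableSpace Ω] {P : Measure Ω} [IsProbabilityMeasure P]
  {τ : Ω → EReal} {Y : Ω → ℝ} {Ω₁ : Type*} [MeasurableSpace Ω₁] {Q : Measure Ω₁}
  [IsProbabilityMeasure Q] {R : Ω₁ → ℕ} {σm : ℕ → Ω₁ → ℝ} {τm : Ω₁ → ℝ} {r : ℝ}

omit [IsProbabilityMeasure Q] in
-- On the success event `τ` lies below a real number and is almost surely positive, so the default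
-- values of `toReal` at `⊤` and `⊥` play no role.
theorem survival_toReal (h : IsSearchWithResetting P τ Y)
    (hD : IsResetDecomposition P τ Y r Q R σm τm) (t : ℝ) :
    Q.real {ω | t < τm ω} =
      (cond P (successEvent τ Y r)).real {ω | t < (τ ω).toReal} := by
  rw [hD.survival_τm t]
  refine measureReal_congr ?_
  filter_upwards [ae_cond_mem (measurableSet_successEvent h r),
    cond_absolutelyContinuous.ae_le (ae_search_pos h)] with ω h1 h2
  have hne_bot : τ ω ≠ ⊥ := (EReal.bot_lt_zero.trans h2).ne'
  have hne_top : τ ω ≠ ⊤ := (lt_of_lt_of_le h1 le_top).ne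
  refine propext ?_
  change (t : EReal) < τ ω ↔ t < (τ ω).toReal
  rw [← EReal.coe_lt_coe_iff, EReal.coe_toReal hne_top hne_bot]

theorem ofReal_div_pow {r : ℝ} (hr : 0 < r) (y : ℝ) (k : ℕ) :
    ENNReal.ofReal (y / r) ^ k = ENNReal.ofReal y ^ k * (ENNReal.ofReal r)⁻¹ ^ k := by
  rw [ENNReal.ofReal_div_of_pos hr, div_eq_mul_inv, mul_pow]

theorem lintegral_unsuccessful_pow (h : IsSearchWithResetting P τ Y)
    (hD : IsResetDecomposition P τ Y r Q R σm τm) (hr : 0 < r)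
    (hf : P (failureEvent τ Y r) ≠ 0) (n k : ℕ) :
    ∫⁻ ω, ENNReal.ofReal (σm n ω) ^ k ∂Q = (P (failureEvent τ Y r))⁻¹ *
      ((∫⁻ ω in failureEvent τ Y r, ENNReal.ofReal (Y ω) ^ k ∂P) * (ENNReal.ofReal r)⁻¹ ^ k) := by
  have hYm := h.measurable_reset
  have hσ : Measurable (resetTime Y r) := hYm.div_const r
  rw [lintegral_comp_of_survival hσ (hD.measurable_σm n) hf (hD.survival_σm n)
    (g := fun x => ENNReal.ofReal x ^ k) (by fun_prop), ← lintegral_mul_const _ (by fun_prop)]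
  congr 1
  refine lintegral_congr fun ω => ?_
  exact ofReal_div_pow hr _ _

/-- Enlarging the failure event to the whole space gives exponential moments. Replacing its inverse
probability by the `k`-th power, for `k ≥ 1`, puts the bound in the form `k! a^k`. -/
theorem lintegral_unsuccessful_pow_le (h : IsSearchWithResetting P τ Y)
    (hY : IsUnitExponential P Y)
    (hD : IsResetDecomposition P τ Y r Q R σm τm) (hr : 0 < r)
    (hf : P (failureEvent τ Y r) ≠ 0) (n k : ℕ) :
    ∫⁻ ω, ENNReal.ofReal (σm n ω) ^ k ∂Q ≤ (k.factorial : ℝ≥0∞) *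
      ((P (failureEvent τ Y r))⁻¹ * (ENNReal.ofReal r)⁻¹) ^ k := by
  rcases Nat.eq_zero_or_pos k with rfl | hk
  · simp
  rw [lintegral_unsuccessful_pow h hD hr hf]
  have h1 : (1 : ℝ≥0∞) ≤ (P (failureEvent τ Y r))⁻¹ := ENNReal.one_le_inv.2 prob_le_one
  calc _ ≤ (P (failureEvent τ Y r))⁻¹ ^ k * ((k.factorial : ℝ≥0∞) * (ENNReal.ofReal r)⁻¹ ^ k) := by
        gcongr
        · exact le_self_pow h1 hk.ne'
        · exact (setLIntegral_le_lintegral _ _).trans_eq (lintegral_reset_pow h hY k)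
    _ = _ := by rw [mul_pow]; ring

/-- On success `τ < Y/r`. The restriction to the success event is kept: the remaining integral
vanishes in the limit, while the inverse probability is later cancelled by a factor `p`. -/
theorem lintegral_successful_pow_le (h : IsSearchWithResetting P τ Y)
    (hD : IsResetDecomposition P τ Y r Q R σm τm) (hr : 0 < r)
    (hs : P (successEvent τ Y r) ≠ 0) (k : ℕ) :
    ∫⁻ ω, ENNReal.ofReal (τm ω) ^ k ∂Q ≤ (P (successEvent τ Y r))⁻¹ *
      ((∫⁻ ω in successEvent τ Y r, ENNReal.ofReal (Y ω) ^ k ∂P) * (ENNReal.ofReal r)⁻¹ ^ k) := by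
  have hYm := h.measurable_reset
  rw [lintegral_comp_of_survival h.measurable_search.ereal_toReal hD.measurable_τm hs
    (survival_toReal h hD) (g := fun x => ENNReal.ofReal x ^ k) (by fun_prop),
    ← lintegral_mul_const _ (by fun_prop)]
  refine mul_le_mul_right (lintegral_mono_ae ?_) _
  filter_upwards [self_mem_ae_restrict (measurableSet_successEvent h r),
    ae_restrict_of_ae (ae_search_pos h)] with ω h1 h2
  rw [← ofReal_div_pow hr]
  have hne_bot : τ ω ≠ ⊥ := (EReal.bot_lt_zero.trans h2).ne'
  have h3 : (τ ω).toReal ≤ Y ω / r := by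
    have h4 := EReal.toReal_le_toReal (le_of_lt h1) hne_bot (EReal.coe_ne_top _)
    rwa [EReal.toReal_coe] at h4
  gcongr

theorem ae_totalSearchTime (h : IsSearchWithResetting P τ Y) (hY : IsUnitExponential P Y)
    (hD : IsResetDecomposition P τ Y r Q R σm τm) (hr : 0 < r)
    (hf : P (failureEvent τ Y r) ≠ 0) (hs : P (successEvent τ Y r) ≠ 0) :
    ∀ᵐ ω ∂Q, 0 ≤ totalSearchTime R σm τm ω ∧ ENNReal.ofReal (totalSearchTime R σm τm ω) =
      (∑ i ∈ Finset.range (R ω), ENNReal.ofReal (σm i ω)) + ENNReal.ofReal (τm ω) := by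
  have hσ : Measurable (resetTime Y r) := h.measurable_reset.div_const r
  have h1 : ∀ᵐ ω ∂Q, ∀ n, 0 ≤ σm n ω := by
    refine ae_all_iff.2 fun n => ?_
    refine ae_nonneg_of_survival hσ (hD.measurable_σm n) hf (hD.survival_σm n) ?_
    filter_upwards [ae_reset_pos h hY] with ω hω
    exact div_nonneg hω.le hr.le
  have h2 : ∀ᵐ ω ∂Q, 0 ≤ τm ω := by
    refine ae_nonneg_of_survival h.measurable_search.ereal_toReal hD.measurable_τm hs
      (survival_toReal h hD) ?_
    filter_upwards [ae_search_pos h] with ω hω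
    exact EReal.toReal_nonneg hω.le
  filter_upwards [h1, h2] with ω h1 h2
  have h3 : 0 ≤ ∑ n ∈ Finset.range (R ω), σm n ω := Finset.sum_nonneg fun i _ => h1 i
  refine ⟨add_nonneg h3 h2, ?_⟩
  rw [totalSearchTime, ENNReal.ofReal_add h3 h2, ENNReal.ofReal_sum_of_nonneg fun i _ => h1 i]

omit [IsProbabilityMeasure P] [IsProbabilityMeasure Q] in
theorem measurable_totalSearchTime (hD : IsResetDecomposition P τ Y r Q R σm τm) :
    Measurable (totalSearchTime R σm τm) := by
  refine Measurable.add ?_ hD.measurable_τm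
  have h1 : Measurable fun z : ℕ × Ω₁ => ∑ n ∈ Finset.range z.1, σm n z.2 :=
    measurable_from_prod_countable_right fun k =>
      Finset.measurable_sum (Finset.range k) fun i _ => hD.measurable_σm i
  exact h1.comp (hD.measurable_R.prodMk measurable_id)

theorem measure_successEvent_eq : P (successEvent τ Y r) = ENNReal.ofReal (successProb P τ Y r) :=
  (ofReal_measureReal).symm

omit [IsProbabilityMeasure P] in
theorem measure_R_eq (hD : IsResetDecomposition P τ Y r Q R σm τm) (n : ℕ) :
    Q {ω | R ω = n} =
      ENNReal.ofReal ((1 - successProb P τ Y r) ^ n * successProb P τ Y r) := by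
  rw [← hD.prob_R n, ofReal_measureReal]

/-- In the binomial expansion, `(rp)^j` cancels the growth of the geometric sum. For `j < m`, the
factor `(rp)^{m-j}` cancels the powers of `1/r` and the inverse of `p` from `τ⁻`, and the leftover
`p^{m-j-1}` is at most `1`. For `j = m` the moment of `τ⁻` is the zeroth one, which is `1` and not
small. -/
theorem scaled_moment_le (h : IsSearchWithResetting P τ Y) (hY : IsUnitExponential P Y)
    (hD : IsResetDecomposition P τ Y r Q R σm τm) (hr : 0 < r)
    (hf : P (failureEvent τ Y r) ≠ 0) (hs : P (successEvent τ Y r) ≠ 0) (m : ℕ) :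
    ENNReal.ofReal (r * successProb P τ Y r) ^ m *
        ∫⁻ ω, ENNReal.ofReal (totalSearchTime R σm τm ω) ^ m ∂Q ≤
      ∑ j ∈ Finset.range (m + 1), (m.choose j : ℝ≥0∞) * (j.factorial : ℝ≥0∞) *
        (P (failureEvent τ Y r))⁻¹ ^ j * (if j = m then 1 else
          ∫⁻ ω in successEvent τ Y r, ENNReal.ofReal (Y ω) ^ (m - j) ∂P) := by
  have hσm := hD.measurable_σm
  have hτm := hD.measurable_τm
  have hp0 : 0 < successProb P τ Y r := ENNReal.toReal_pos hs (measure_ne_top _ _)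
  have hp1 : successProb P τ Y r ≤ 1 := measureReal_le_one
  have hle1 : P (successEvent τ Y r) ≤ 1 := prob_le_one
  have h1 : ∫⁻ ω, ENNReal.ofReal (totalSearchTime R σm τm ω) ^ m ∂Q =
      ∫⁻ ω, ((∑ i ∈ Finset.range (R ω), ENNReal.ofReal (σm i ω)) + ENNReal.ofReal (τm ω)) ^ m ∂Q := by
    refine lintegral_congr_ae ?_
    filter_upwards [ae_totalSearchTime h hY hD hr hf hs] with ω hω
    rw [hω.2]
  have h2 := lintegral_geometric_sum_pow_le (Q := Q) (R := R)
    (X := fun n ω => ENNReal.ofReal (σm n ω)) (Z := fun ω => ENNReal.ofReal (τm ω))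
    hD.measurable_R (fun n => by fun_prop) (by fun_prop)
    (hD.indep_σm.comp (fun _ => ENNReal.ofReal) (fun _ => ENNReal.measurable_ofReal))
    (hD.indep_σm_τm.comp (φ := fun x n => ENNReal.ofReal (x n)) (ψ := ENNReal.ofReal)
      (by fun_prop) (by fun_prop))
    (hD.indep_R.comp (φ := id)
      (ψ := fun z : (ℕ → ℝ) × ℝ => ((fun n => ENNReal.ofReal (z.1 n)), ENNReal.ofReal z.2))
      measurable_id (by fun_prop))
    hp0 hp1 (measure_R_eq hD) (lintegral_unsuccessful_pow_le h hY hD hr hf) m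
  rw [h1]
  refine (mul_le_mul_right h2 _).trans ?_
  rw [Finset.mul_sum]
  refine Finset.sum_le_sum fun j hj => ?_
  have hjm : j ≤ m := Nat.lt_succ_iff.1 (Finset.mem_range.1 hj)
  have hr0 : ENNReal.ofReal r ≠ 0 := (ENNReal.ofReal_pos.2 hr).ne'
  have hcancel_r : ∀ k : ℕ, ENNReal.ofReal r ^ k * (ENNReal.ofReal r)⁻¹ ^ k = 1 := fun k => by
    rw [← mul_pow, ENNReal.mul_inv_cancel hr0 ENNReal.ofReal_ne_top, one_pow]
  have hcancel_p : ENNReal.ofReal (successProb P τ Y r) ^ j *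
      ENNReal.ofReal (1 / successProb P τ Y r ^ j) = 1 := by
    rw [← ENNReal.ofReal_pow hp0.le, ← ENNReal.ofReal_mul (by positivity), mul_one_div_cancel
      (by positivity), ENNReal.ofReal_one]
  have hrem : ENNReal.ofReal (r * successProb P τ Y r) ^ (m - j) *
      ∫⁻ ω, ENNReal.ofReal (τm ω) ^ (m - j) ∂Q ≤ (if j = m then 1 else
          ∫⁻ ω in successEvent τ Y r, ENNReal.ofReal (Y ω) ^ (m - j) ∂P) := by
    split_ifs with hjm'
    · simp [hjm']
    obtain ⟨i, hi⟩ : ∃ i, m - j = i + 1 := ⟨m - j - 1, by omega⟩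
    rw [hi]
    refine (mul_le_mul_right (lintegral_successful_pow_le h hD hr hs (i + 1)) _).trans ?_
    rw [ENNReal.ofReal_mul hr.le, ← measure_successEvent_eq, mul_pow]
    calc _ = (ENNReal.ofReal r ^ (i + 1) * (ENNReal.ofReal r)⁻¹ ^ (i + 1)) *
          (P (successEvent τ Y r) * (P (successEvent τ Y r))⁻¹) * P (successEvent τ Y r) ^ i *
          ∫⁻ ω in successEvent τ Y r, ENNReal.ofReal (Y ω) ^ (i + 1) ∂P := by ring
      _ ≤ _ := by
        rw [hcancel_r, ENNReal.mul_inv_cancel hs (measure_ne_top _ _), one_mul, one_mul]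
        exact mul_le_of_le_one_left' (pow_le_one₀ zero_le hle1)
  have hsplit : ENNReal.ofReal (r * successProb P τ Y r) ^ m =
      ENNReal.ofReal r ^ j * ENNReal.ofReal (successProb P τ Y r) ^ j *
        ENNReal.ofReal (r * successProb P τ Y r) ^ (m - j) := by
    rw [← mul_pow, ← ENNReal.ofReal_mul hr.le, ← pow_add, Nat.add_sub_cancel' hjm]
  rw [hsplit, mul_pow]
  calc _ = (m.choose j : ℝ≥0∞) * (j.factorial : ℝ≥0∞) * (P (failureEvent τ Y r))⁻¹ ^ j *
        (ENNReal.ofReal r ^ j * (ENNReal.ofReal r)⁻¹ ^ j) *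
        (ENNReal.ofReal (successProb P τ Y r) ^ j *
          ENNReal.ofReal (1 / successProb P τ Y r ^ j)) *
        (ENNReal.ofReal (r * successProb P τ Y r) ^ (m - j) *
          ∫⁻ ω, ENNReal.ofReal (τm ω) ^ (m - j) ∂Q) := by ring
    _ ≤ _ := by
      rw [hcancel_r, hcancel_p, mul_one, mul_one]
      gcongr

/-- The mean of `σ⁻` is at least `1/r` times the integral of `Y` over the failure event, since the
inverse probability of failure is at least `1`. -/
theorem le_scaled_moment (h : IsSearchWithResetting P τ Y) (hY : IsUnitExponential P Y)
    (hD : IsResetDecomposition P τ Y r Q R σm τm) (hr : 0 < r)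
    (hf : P (failureEvent τ Y r) ≠ 0) (hs : P (successEvent τ Y r) ≠ 0) {m : ℕ} (hm : 1 ≤ m) :
    (∫⁻ ω in failureEvent τ Y r, ENNReal.ofReal (Y ω) ^ 1 ∂P) ^ m * (m.factorial : ℝ≥0∞) *
        (1 - P (successEvent τ Y r)) ^ m ≤
      ENNReal.ofReal (r * successProb P τ Y r) ^ m *
        ∫⁻ ω, ENNReal.ofReal (totalSearchTime R σm τm ω) ^ m ∂Q := by
  have hσm := hD.measurable_σm
  have hτm := hD.measurable_τm
  have hp0 : 0 < successProb P τ Y r := ENNReal.toReal_pos hs (measure_ne_top _ _)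
  have hp1 : successProb P τ Y r ≤ 1 := measureReal_le_one
  have h1 : ∫⁻ ω, ENNReal.ofReal (totalSearchTime R σm τm ω) ^ m ∂Q =
      ∫⁻ ω, ((∑ i ∈ Finset.range (R ω), ENNReal.ofReal (σm i ω)) + ENNReal.ofReal (τm ω)) ^ m ∂Q := by
    refine lintegral_congr_ae ?_
    filter_upwards [ae_totalSearchTime h hY hD hr hf hs] with ω hω
    rw [hω.2]
  set I := ∫⁻ ω in failureEvent τ Y r, ENNReal.ofReal (Y ω) ^ 1 ∂P with hI
  have h2 := le_lintegral_geometric_sum_pow (Q := Q) (R := R)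
    (X := fun n ω => ENNReal.ofReal (σm n ω)) (Z := fun ω => ENNReal.ofReal (τm ω))
    hD.measurable_R (fun n => by fun_prop) (by fun_prop)
    (hD.indep_R.comp (φ := id)
      (ψ := fun z : (ℕ → ℝ) × ℝ => ((fun n => ENNReal.ofReal (z.1 n)), ENNReal.ofReal z.2))
      measurable_id (by fun_prop))
    hp0 hp1 (measure_R_eq hD) (μ := I * (ENNReal.ofReal r)⁻¹)
    (fun n => by
      have h3 := lintegral_unsuccessful_pow h hD hr hf n 1
      simp only [pow_one] at h3 hI ⊢
      rw [h3, ← hI]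
      exact le_mul_of_one_le_left' (ENNReal.one_le_inv.2 prob_le_one)) hm
  rw [h1]
  refine le_trans (le_of_eq ?_) (mul_le_mul_right h2 _)
  have hr0 : ENNReal.ofReal r ≠ 0 := (ENNReal.ofReal_pos.2 hr).ne'
  have hcancel_r : ENNReal.ofReal r ^ m * (ENNReal.ofReal r)⁻¹ ^ m = 1 := by
    rw [← mul_pow, ENNReal.mul_inv_cancel hr0 ENNReal.ofReal_ne_top, one_pow]
  have hcancel_p : ENNReal.ofReal (successProb P τ Y r) ^ m *
      ENNReal.ofReal ((1 - successProb P τ Y r) ^ m / successProb P τ Y r ^ m) =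
      (1 - P (successEvent τ Y r)) ^ m := by
    rw [← ENNReal.ofReal_pow hp0.le, ← ENNReal.ofReal_mul (by positivity), mul_div_cancel₀ _
      (by positivity), ENNReal.ofReal_pow (by linarith), measure_successEvent_eq,
      ENNReal.ofReal_sub _ hp0.le, ENNReal.ofReal_one]
  rw [ENNReal.ofReal_mul hr.le, mul_pow, mul_pow]
  calc _ = I ^ m * (m.factorial : ℝ≥0∞) * (ENNReal.ofReal r ^ m * (ENNReal.ofReal r)⁻¹ ^ m) *
        (ENNReal.ofReal (successProb P τ Y r) ^ m *
          ENNReal.ofReal ((1 - successProb P τ Y r) ^ m / successProb P τ Y r ^ m)) := by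
        rw [hcancel_r, hcancel_p, mul_one]
    _ = _ := by ring

end Decomposition

/-! ### The limit of the scaled moments and the conclusion -/

theorem tendsto_scaled_moment {Ω : Type*} [MeasurableSpace Ω] {P : Measure Ω}
    [IsProbabilityMeasure P] {τ : Ω → EReal} {Y : Ω → ℝ} (h : IsSearchWithResetting P τ Y)
    (hY : IsUnitExponential P Y) {Ω₁ : ℝ → Type*} [∀ r, MeasurableSpace (Ω₁ r)]
    {Q : ∀ r, Measure (Ω₁ r)} [∀ r, IsProbabilityMeasure (Q r)]
    {R : ∀ r, Ω₁ r → ℕ} {σm : ∀ r, ℕ → Ω₁ r → ℝ} {τm : ∀ r, Ω₁ r → ℝ}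
    (hT : ∀ r : ℝ, 0 < r → IsResetDecomposition P τ Y r (Q r) (R r) (σm r) (τm r))
    (hs : ∀ᶠ r in atTop, P (successEvent τ Y r) ≠ 0) {m : ℕ} (hm : 1 ≤ m) :
    Tendsto (fun r => ENNReal.ofReal (r * successProb P τ Y r) ^ m *
      ∫⁻ ω, ENNReal.ofReal (totalSearchTime (R r) (σm r) (τm r) ω) ^ m ∂(Q r)) atTop
      (𝓝 (m.factorial : ℝ≥0∞)) := by
  have hfail : Tendsto (fun r => P (failureEvent τ Y r)) atTop (𝓝 1) := by
    simpa using tendsto_setLIntegral_failureEvent h hY 0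
  have hsucc : Tendsto (fun r => P (successEvent τ Y r)) atTop (𝓝 0) := by
    simpa using tendsto_setLIntegral_successEvent h hY 0
  have hf : ∀ᶠ r in atTop, P (failureEvent τ Y r) ≠ 0 := hfail.eventually_ne one_ne_zero
  have hmean : Tendsto (fun r => ∫⁻ ω in failureEvent τ Y r, ENNReal.ofReal (Y ω) ^ 1 ∂P) atTop
      (𝓝 1) := by
    simpa using tendsto_setLIntegral_failureEvent h hY 1
  have hlow : Tendsto (fun r => (∫⁻ ω in failureEvent τ Y r, ENNReal.ofReal (Y ω) ^ 1 ∂P) ^ m *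
      (m.factorial : ℝ≥0∞) * (1 - P (successEvent τ Y r)) ^ m) atTop
      (𝓝 (m.factorial : ℝ≥0∞)) := by
    have hsub : Tendsto (fun r => (1 - P (successEvent τ Y r)) ^ m) atTop (𝓝 1) := by
      have := ENNReal.Tendsto.pow (n := m) (ENNReal.Tendsto.sub
        (tendsto_const_nhds (x := (1 : ℝ≥0∞))) hsucc (Or.inl ENNReal.one_ne_top))
      simpa using this
    have h1 := ENNReal.Tendsto.mul_const (b := (m.factorial : ℝ≥0∞)) (ENNReal.Tendsto.pow (n := m) hmean)
      (Or.inr (ENNReal.natCast_ne_top _))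
    rw [one_pow, one_mul] at h1
    have h2 := ENNReal.Tendsto.mul h1 (Or.inr ENNReal.one_ne_top) hsub
      (Or.inr (ENNReal.natCast_ne_top _))
    rwa [mul_one] at h2
  have hup : Tendsto (fun r => ∑ j ∈ Finset.range (m + 1), (m.choose j : ℝ≥0∞) *
      (j.factorial : ℝ≥0∞) * (P (failureEvent τ Y r))⁻¹ ^ j * (if j = m then 1 else
        ∫⁻ ω in successEvent τ Y r, ENNReal.ofReal (Y ω) ^ (m - j) ∂P)) atTop
      (𝓝 (m.factorial : ℝ≥0∞)) := by
    -- Only `j = m` survives: every other term contains an integral over the vanishing success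
    -- event.
    have hsum : (m.factorial : ℝ≥0∞) = ∑ j ∈ Finset.range (m + 1), (m.choose j : ℝ≥0∞) *
        (j.factorial : ℝ≥0∞) * (if j = m then 1 else 0) := by
      rw [Finset.sum_range_succ, Finset.sum_eq_zero]
      · simp
      · intro j hj
        simp [(Finset.mem_range.1 hj).ne]
    rw [hsum]
    refine tendsto_finsetSum _ fun j _ => ?_
    have hcst : (m.choose j : ℝ≥0∞) * (j.factorial : ℝ≥0∞) ≠ ∞ :=
      ENNReal.mul_ne_top (ENNReal.natCast_ne_top _) (ENNReal.natCast_ne_top _)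
    have hinv : Tendsto (fun r => (P (failureEvent τ Y r))⁻¹ ^ j) atTop (𝓝 1) := by
      have := ENNReal.Tendsto.pow (n := j) (tendsto_inv_iff.2 hfail)
      simpa using this
    have h1 := ENNReal.Tendsto.const_mul (a := (m.choose j : ℝ≥0∞) * (j.factorial : ℝ≥0∞)) hinv
      (Or.inr hcst)
    rw [mul_one] at h1
    split_ifs with hj
    · simpa using h1
    · exact ENNReal.Tendsto.mul h1 (Or.inr ENNReal.zero_ne_top)
        (tendsto_setLIntegral_successEvent h hY (m - j)) (Or.inr hcst)
  refine tendsto_of_tendsto_of_tendsto_of_le_of_le' hlow hup ?_ ?_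
  · filter_upwards [hs, hf, eventually_gt_atTop 0] with r hs hf hr
    exact le_scaled_moment h hY (hT r hr) hr hf hs hm
  · filter_upwards [hs, hf, eventually_gt_atTop 0] with r hs hf hr
    exact scaled_moment_le h hY (hT r hr) hr hf hs m

theorem theorem3
    {Ω : Type*} [MeasurableSpace Ω] (P : Measure Ω) [IsProbabilityMeasure P]
    (τ : Ω → EReal) (Y : Ω → ℝ)
    (hsearch : IsSearchWithResetting P τ Y)
    (hY : IsUnitExponential P Y)
    {Ω₁ : ℝ → Type*} [∀ r, MeasurableSpace (Ω₁ r)]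
    (Q : ∀ r, Measure (Ω₁ r)) [∀ r, IsProbabilityMeasure (Q r)]
    (R : ∀ r, Ω₁ r → ℕ) (σm : ∀ r, ℕ → Ω₁ r → ℝ) (τm : ∀ r, Ω₁ r → ℝ)
    (hT : ∀ r : ℝ, 0 < r → IsResetDecomposition P τ Y r (Q r) (R r) (σm r) (τm r))
    (A C b : ℝ) (hA : 0 < A) (hC : 0 < C)
    (hF : (fun t : ℝ => searchCDF P τ t) ~[𝓝[>] 0]
      (fun t : ℝ => A * t ^ b * Real.exp (-C / t))) :
    ((fun r : ℝ => successProb P τ Y r) ~[atTop]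
      (fun r : ℝ => A * Real.sqrt (Real.pi * C ^ ((2 * b + 1) / 2)) * r ^ ((1 - 2 * b) / 4) *
        Real.exp (-Real.sqrt (4 * C * r)))) ∧
    ∀ m : ℕ, 1 ≤ m →
      (∀ᶠ r : ℝ in atTop,
        Integrable (fun ω => totalSearchTime (R r) (σm r) (τm r) ω ^ m) (Q r)) ∧
      ((fun r : ℝ => ∫ ω, totalSearchTime (R r) (σm r) (τm r) ω ^ m ∂(Q r)) ~[atTop]
        (fun r : ℝ => (m.factorial : ℝ) *
          (1 / (A * Real.sqrt (Real.pi * C ^ ((2 * b + 1) / 2))) * r ^ ((2 * b - 5) / 4) *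
            Real.exp (Real.sqrt (4 * C * r))) ^ m)) := by 
  have hp := successProb_isEquivalent hsearch hY hA hC hF
  refine ⟨hp, fun m hm => ?_⟩
  set K := A * Real.sqrt (Real.pi * C ^ ((2 * b + 1) / 2)) with hK
  have hK0 : 0 < K := by positivity
  have hppos : ∀ᶠ r in atTop, 0 < successProb P τ Y r := by
    have hne : ∀ᶠ r : ℝ in atTop, K * r ^ ((1 - 2 * b) / 4) *
        Real.exp (-Real.sqrt (4 * C * r)) ≠ 0 := by
      filter_upwards [eventually_gt_atTop 0] with r hr
      positivity
    have h1 := (isEquivalent_iff_tendsto_one hne).1 hp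
    filter_upwards [h1.eventually_ne one_ne_zero] with r hr
    refine lt_of_le_of_ne measureReal_nonneg fun h0 => hr ?_
    simp [← h0]
  have hs : ∀ᶠ r in atTop, P (successEvent τ Y r) ≠ 0 := by
    filter_upwards [hppos] with r hr
    exact (ENNReal.toReal_pos_iff.1 hr).1.ne'
  have hf : ∀ᶠ r in atTop, P (failureEvent τ Y r) ≠ 0 := by
    have hfail : Tendsto (fun r => P (failureEvent τ Y r)) atTop (𝓝 1) := by
      simpa using tendsto_setLIntegral_failureEvent hsearch hY 0
    exact hfail.eventually_ne one_ne_zero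
  have hlim := tendsto_scaled_moment hsearch hY hT hs hm
  -- The scaled moment has a finite limit and its scale `rp` is positive, so an infinite moment is
  -- eventually impossible.
  have hfin : ∀ᶠ r in atTop,
      ∫⁻ ω, ENNReal.ofReal (totalSearchTime (R r) (σm r) (τm r) ω) ^ m ∂(Q r) ≠ ∞ := by
    filter_upwards [hlim.eventually_ne (ENNReal.natCast_ne_top m.factorial), hppos, eventually_gt_atTop 0] with r hr hp0 hr0 htop
    rw [htop, ENNReal.mul_top (pow_ne_zero _ (ENNReal.ofReal_pos.2 (mul_pos hr0 hp0)).ne')] at hr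
    exact hr rfl
  have hcongr : ∀ᶠ r in atTop, (∀ᵐ ω ∂(Q r), 0 ≤ totalSearchTime (R r) (σm r) (τm r) ω ^ m) ∧
      ∫⁻ ω, ENNReal.ofReal (totalSearchTime (R r) (σm r) (τm r) ω ^ m) ∂(Q r) =
      ∫⁻ ω, ENNReal.ofReal (totalSearchTime (R r) (σm r) (τm r) ω) ^ m ∂(Q r) := by
    filter_upwards [hs, hf, eventually_gt_atTop 0] with r hs hf hr
    have h1 := ae_totalSearchTime hsearch hY (hT r hr) hr hf hs
    constructor
    · filter_upwards [h1] with ω hω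
      exact pow_nonneg hω.1 m
    · refine lintegral_congr_ae ?_
      filter_upwards [h1] with ω hω
      exact ENNReal.ofReal_pow hω.1 m
  refine ⟨?_, ?_⟩
  · filter_upwards [hfin, hcongr, eventually_gt_atTop 0] with r hfin hcongr hr
    refine ⟨((measurable_totalSearchTime (hT r hr)).pow_const m).aestronglyMeasurable, ?_⟩
    rw [hasFiniteIntegral_iff_ofReal hcongr.1, hcongr.2]
    exact hfin.lt_top
  have hreal : Tendsto (fun r => (r * successProb P τ Y r) ^ m *
      ∫ ω, totalSearchTime (R r) (σm r) (τm r) ω ^ m ∂(Q r)) atTop (𝓝 (m.factorial : ℝ)) := by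
    have h1 := (ENNReal.tendsto_toReal (ENNReal.natCast_ne_top m.factorial)).comp hlim
    rw [ENNReal.toReal_natCast] at h1
    refine h1.congr' ?_
    filter_upwards [hcongr, hppos, eventually_gt_atTop 0] with r hcongr hp0 hr
    rw [integral_eq_lintegral_of_nonneg_ae hcongr.1
      ((measurable_totalSearchTime (hT r hr)).pow_const m).aestronglyMeasurable, hcongr.2,
      Function.comp_apply, ENNReal.toReal_mul, ENNReal.toReal_pow,
      ENNReal.toReal_ofReal (by positivity)]
  have hfact : (m.factorial : ℝ) ≠ 0 := by positivity
  -- `E[T^m]` is `(rp)^m E[T^m]`, equivalent to `m!`, times `(rp)^{-m}`, whose asymptotics are those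
  -- of `p`.
  have hequiv := ((isEquivalent_const_iff_tendsto hfact).2 hreal).mul
    (((IsEquivalent.refl (u := fun r : ℝ => r) (l := atTop)).mul hp).inv.pow m)
  refine (hequiv.congr_left ?_).congr_right ?_
  · filter_upwards [hppos, eventually_gt_atTop 0] with r hp0 hr
    simp only [Pi.mul_apply, Pi.pow_apply, Pi.inv_apply]
    have h1 : (r * successProb P τ Y r) ^ m ≠ 0 := by positivity
    rw [inv_pow, mul_comm, inv_mul_cancel_left₀ h1]
  · filter_upwards [eventually_gt_atTop 0] with r hr
    simp only [Pi.mul_apply, Pi.pow_apply, Pi.inv_apply]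
    -- The extra factor `r` explains the exponent: `-(1 + (1-2b)/4) = (2b-5)/4`.
    have h1 : r ^ ((2 * b - 5) / 4) = (r * r ^ ((1 - 2 * b) / 4))⁻¹ := by
      nth_rewrite 2 [← Real.rpow_one r]
      rw [← Real.rpow_add hr, ← Real.rpow_neg hr.le]
      congr 1; ring
    rw [h1, Real.exp_neg]
    generalize r ^ ((1 - 2 * b) / 4) = x
    have hE := Real.exp_pos (Real.sqrt (4 * C * r))
    generalize Real.exp (Real.sqrt (4 * C * r)) = E at hE
    have h2 : (r * (K * x * E⁻¹))⁻¹ = 1 / K * (r * x)⁻¹ * E := by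
      simp only [mul_inv, inv_inv, one_div]
      ring
    rw [h2, Function.const_apply]
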